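/- **Setting.** Fix a density $\lambda>0$, a transmission probability $\rho\in[0,1]$, a number $M\ge 1$ of resource blocks, a SINR threshold $\xi>0$ and $\sigma>0$ (where $\sigma^2$ is the noise power divided by the common transmit power). A typical node is located at the origin of $\mathbb{R}^2$; the other nodes are located at the points $X_1,X_2,\dots$ of a homogeneous Poisson point process of density $\lambda$ on $\mathbb{R}^2$. In a time slot each node, the typical node included, independently transmits with probability $\rho$ and otherwise receives; each transmitting node uses one of the $M$ resource blocks, chosen uniformly and independently. Let $h_j$ and $g_j$ be the fading power gains of the link from node $j$ to the typical node when the signal of node $j$ is the desired signal, respectively an interfering signal. Under Rayleigh fading all $h_j$ and all $g_j$ are exponentially distributed with mean $1$, and the pairs $(h_j,g_j)$ are independent for different $j$ (no assumption is made on the dependence between $h_j$ and $g_j$ for the same $j$, so that $h_j=g_j$ is allowed). Locations, transmission modes, resource blocks and fading pairs are independent of each other. With path-loss exponent $\alpha$, the SINR at the typical node of the packet of a transmitting node $i$ is $$\Xi_i=\frac{|X_i|^{-\alpha}h_i}{\sum_{j}|X_j|^{-\alpha}g_j+\sigma^2},$$ where the sum is over the transmitting nodes $j\ne i$ that use the same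 resource block as node $i$. The typical node discovers node $i$ if the typical node receives, node $i$ transmits, and $\Xi_i>\xi$. Let $S$ be the number of nodes that the typical node discovers in the slot, over all $M$ resource blocks. **Proposition.** If all links experience Rayleigh fading, $\alpha=4$ and $\sigma^2>0$, then $$\mathbb{E}\{S\}=\frac{\lambda\pi^{3/2}\rho(1-\rho)}{2\sqrt{\xi\sigma^2}}\exp\!\left(\left(\frac{\lambda\pi^2\rho}{4M\sigma}\right)^2\right)\operatorname{erfc}\!\left(\frac{\lambda\pi^2\rho}{4M\sigma}\right),$$ where $\operatorname{erfc}(x)=\frac{2}{\sqrt{\pi}}\int_x^\infty e^{-t^2}\,dt$. -/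

import Mathlib

open MeasureTheory ProbabilityTheory
open scoped ENNReal

/-- The complementary error function `erfc x = (2/√π) ∫_x^∞ exp (-t²) dt`. -/
noncomputable def erfc (x : ℝ) : ℝ :=
  2 / Real.sqrt Real.pi * ∫ t in Set.Ioi x, Real.exp (-t ^ 2)

/-- The Euclidean plane. -/
abbrev Plane : Type := EuclideanSpace ℝ (Fin 2)

/-- The number of points of the (random) sequence `X` that lie in `A`. -/
noncomputable def pointCount {Ω : Type*} (X : ℕ → Ω → Plane) (A : Set Plane) (ω : Ω) : ℕ∞ :=
  Set.encard {i | X i ω ∈ A}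

/-- The random points `X 0, X 1, …` are an enumeration of a homogeneous Poisson point process of
density `lam > 0` on the plane: numbers of points in Borel sets of finite area are Poisson with
mean `lam` times the area, and are independent for pairwise disjoint sets. -/
structure IsHomogeneousPPP {Ω : Type*} [MeasurableSpace Ω] (P : Measure Ω)
    (lam : ℝ) (X : ℕ → Ω → Plane) : Prop where
  measurable : ∀ i, Measurable (X i)
  count_law : ∀ A : Set Plane, MeasurableSet A → volume A ≠ ∞ → ∀ n : ℕ,
    P {ω | pointCount X A ω = n} = poissonMeasure (lam * volume.real A).toNNReal {n}
  count_indep : ∀ (k : ℕ) (A : Fin k → Set Plane),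
    (∀ l, MeasurableSet (A l)) → (∀ l, volume (A l) ≠ ∞) →
    Pairwise (fun l l' => Disjoint (A l) (A l')) →
    iIndepFun (fun l => pointCount X (A l)) P

/-- The random quantities in one time slot of the multichannel random hello protocol with `M`
resource blocks, seen from a typical node located at the origin. -/
structure HelloSlot (Ω : Type*) (M : ℕ) where
  /-- location of node `j` -/
  X : ℕ → Ω → Plane
  /-- whether the typical node transmits (`true`) or receives (`false`) -/
  Z₀ : Ω → Bool
  /-- whether node `j` transmits (`true`) or receives (`false`) -/
  Z : ℕ → Ω → Bool
  /-- the resource block that node `j` selects for its hello packets -/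
  B : ℕ → Ω → Fin M
  /-- fading power gain of the signal of node `j` as a desired signal -/
  h : ℕ → Ω → ℝ
  /-- fading power gain of the signal of node `j` as an interfering signal -/
  g : ℕ → Ω → ℝ

namespace HelloSlot

variable {Ω : Type*} {M : ℕ}

/-- All the random marks of node `j`. -/
def mark (s : HelloSlot Ω M) (j : ℕ) (ω : Ω) : Bool × Fin M × ℝ × ℝ :=
  (s.Z j ω, s.B j ω, s.h j ω, s.g j ω)

/-- Interference met at the typical node by the packet of node `i`: the total received power, for
path-loss exponent `α`, from the other nodes transmitting on the resource block of node `i`. -/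
noncomputable def interference (s : HelloSlot Ω M) (α : ℝ) (i : ℕ) (ω : Ω) : ℝ≥0∞ :=
  ∑' j : ℕ, if j ≠ i ∧ s.Z j ω = true ∧ s.B j ω = s.B i ω
    then ENNReal.ofReal (‖s.X j ω‖ ^ (-α) * s.g j ω) else 0

/-- SINR at the typical node of the packet of node `i`, with noise power `noise`
(relative to the common transmit power). -/
noncomputable def sinr (s : HelloSlot Ω M) (α noise : ℝ) (i : ℕ) (ω : Ω) : ℝ≥0∞ :=
  ENNReal.ofReal (‖s.X i ω‖ ^ (-α) * s.h i ω) /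
    (s.interference α i ω + ENNReal.ofReal noise)

/-- The nodes that the typical node discovers in the slot: the typical node receives, node `i`
transmits, and the SINR of its packet exceeds `ξ`. -/
def discovered (s : HelloSlot Ω M) (α noise ξ : ℝ) (ω : Ω) : Set ℕ :=
  {i | s.Z₀ ω = false ∧ s.Z i ω = true ∧ ENNReal.ofReal ξ < s.sinr α noise i ω}

/-- The number `S` of nodes that the typical node discovers over all `M` resource blocks. -/
noncomputable def numDiscovered (s : HelloSlot Ω M) (α noise ξ : ℝ) (ω : Ω) : ℝ≥0∞ :=
  ((s.discovered α noise ξ ω).encard : ℝ≥0∞)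

/-- The probabilistic model under Rayleigh fading: nodes other than the typical one form a
homogeneous Poisson point process of density `lam`; every node, the typical one included, transmits
with probability `ρ`; resource blocks are uniform; desired and interfering fading power gains
are exponential with mean one.  Locations, the mode of the typical node, and the marks of different
nodes are all independent, and for one node so are its mode, its resource block and its gains.
No joint law is imposed on the two gains `h j` and `g j` of one and the same node: they may
coincide (a single gain per link) or be independent. -/
structure IsRayleighModel [MeasurableSpace Ω] (P : Measure Ω)
    (lam ρ : ℝ) (s : HelloSlot Ω M) : Prop where
  ppp : IsHomogeneousPPP P lam s.X
  measurable_Z₀ : Measurable s.Z₀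
  measurable_Z : ∀ j, Measurable (s.Z j)
  measurable_B : ∀ j, Measurable (s.B j)
  measurable_h : ∀ j, Measurable (s.h j)
  measurable_g : ∀ j, Measurable (s.g j)
  law_Z₀ : P {ω | s.Z₀ ω = true} = ENNReal.ofReal ρ
  law_Z : ∀ j, P {ω | s.Z j ω = true} = ENNReal.ofReal ρ
  law_B : ∀ j b, P {ω | s.B j ω = b} = (M : ℝ≥0∞)⁻¹
  law_h : ∀ j, P.map (s.h j) = expMeasure 1
  law_g : ∀ j, P.map (s.g j) = expMeasure 1
  indep_locations :
    IndepFun (fun ω j => s.X j ω) (fun ω => (s.Z₀ ω, fun j => s.mark j ω)) P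
  indep_typical : IndepFun s.Z₀ (fun ω j => s.mark j ω) P
  indep_marks : iIndepFun s.mark P
  indep_mode : ∀ j, IndepFun (s.Z j) (fun ω => (s.B j ω, s.h j ω, s.g j ω)) P
  indep_block : ∀ j, IndepFun (s.B j) (fun ω => (s.h j ω, s.g j ω)) P

end HelloSlot

/-! Condition on the locations. If node `i` uses block `b`, then since `h i` is exponential its
packet is decoded with conditional probability `exp (-(ξ |X i|⁴ (I + σ²)))`, where the interference
`I` depends only on the marks of the other nodes. The expectation over these marks is the Laplace
transform of `I`, which factors over the nodes (`lintegral_expNeg_interference`). Another node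
interferes on `b` with probability `ρ / M` and its gain is again exponential, so its factor is `1 -
(ρ / M) ξ|x|⁴ / (|y|⁴ + ξ|x|⁴)`, with `x` and `y` the locations of the two nodes. Summing over the
`M` blocks cancels the probability `1 / M` of the block of node `i`, and `ρ (1 - ρ)` accounts for
the modes of node `i` and the typical node (`measure_mem_discovered_atLocations`). Only one of `h
j`, `g j` is ever used for the same node, so their joint law is irrelevant.

There remains the mean of a sum over points of a function of the point times a product over all
other points. The Mecke formula together with the generating functional of the Poisson process turns
it into `∫ lam f(x) exp (-lam ∫ (1 - v(x, y)) dy) dx`. All functions here are radial, so this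
formula is proved on annuli, where the counts are independent Poisson variables
(`lintegral_tsum_tprod_label`), and then passed to the limit of vanishing width
(`lintegral_tsum_tprod_radial`).

For path-loss exponent 4 the inner integral is `(π² / 2) √ξ |x|²` up to the factor `ρ / M`. The
outer integrand is therefore the exponential of a quadratic polynomial in `|x|²`; completing the
square produces `erfc` (`lintegral_plane_discovery`). -/

open Filter Topology

/-! ### Radial integrals on the plane and the complementary error function -/

lemma volume_real_ball_plane : (volume : Measure Plane).real (Metric.ball 0 1) = Real.pi := by
  simp [Measure.real, EuclideanSpace.volume_ball_fin_two, Real.pi_pos.le]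

/-- Polar coordinates for radial functions on the plane. -/
lemma integral_norm_plane (f : ℝ → ℝ) :
    ∫ x : Plane, f ‖x‖ = 2 * Real.pi * ∫ r in Set.Ioi (0 : ℝ), r * f r := by
  rw [integral_fun_norm_addHaar volume f, volume_real_ball_plane]
  simp
  ring

lemma integrable_norm_plane_iff {f : ℝ → ℝ} :
    Integrable (fun x : Plane => f ‖x‖) ↔ IntegrableOn (fun r => r * f r) (Set.Ioi 0) := by
  rw [integrable_fun_norm_addHaar volume]
  simp

/-- In polar coordinates the radial integrand has the antiderivative `(√s / 2) arctan (r² / √s)`.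
With `s = ξ|x|⁴` the value is quadratic in `|x|`, which is what makes exponent 4 explicitly
solvable. -/
lemma integral_plane_div_add {s : ℝ} (hs : 0 < s) :
    ∫ y : Plane, s / (‖y‖ ^ 4 + s) = Real.pi ^ 2 / 2 * √s := by
  have hs' : 0 < √s := Real.sqrt_pos.2 hs
  have hss : √s * √s = s := Real.mul_self_sqrt hs.le
  rw [integral_norm_plane (fun r => s / (r ^ 4 + s))]
  have key : ∫ r in Set.Ioi (0 : ℝ), r * (s / (r ^ 4 + s)) =
      √s / 2 * (Real.pi / 2) - √s / 2 * Real.arctan (0 ^ 2 / √s) := by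
    refine integral_Ioi_of_hasDerivAt_of_nonneg'
      (g := fun r => √s / 2 * Real.arctan (r ^ 2 / √s)) (fun r _ => ?_) (fun r hr => ?_) ?_
    · have h := (((hasDerivAt_pow 2 r).div_const (√s)).arctan).const_mul (√s / 2)
      convert! h using 1
      have h1 : r ^ 4 + s ≠ 0 := by positivity
      have h2 : 1 + (r ^ 2 / √s) ^ 2 = (r ^ 4 + s) / s := by
        rw [div_pow, Real.sq_sqrt hs.le]
        field_simp
        ring
      rw [h2]
      field_simp
      norm_num [mul_comm]
    · have : (0 : ℝ) < r := hr
      positivity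
    · refine Tendsto.const_mul _ ?_
      refine (tendsto_nhds_of_tendsto_nhdsWithin Real.tendsto_arctan_atTop).comp ?_
      exact (tendsto_pow_atTop two_ne_zero).atTop_div_const hs'
  rw [key]
  simp
  ring

lemma integrable_exp_neg_sq_real : Integrable (fun t : ℝ => Real.exp (-t ^ 2)) := by
  simpa using integrable_exp_neg_mul_sq (b := 1) one_pos

lemma integral_Ioi_exp_neg_sq_eq (x : ℝ) :
    ∫ t in Set.Ioi x, Real.exp (-t ^ 2) =
      (∫ t in Set.Ioi (0 : ℝ), Real.exp (-t ^ 2)) - ∫ t in (0 : ℝ)..x, Real.exp (-t ^ 2) := by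
  rw [eq_sub_iff_add_eq, add_comm]
  exact intervalIntegral.integral_interval_add_Ioi integrable_exp_neg_sq_real.integrableOn
    integrable_exp_neg_sq_real.integrableOn

lemma hasDerivAt_erfc (x : ℝ) :
    HasDerivAt erfc (-(2 / √Real.pi * Real.exp (-x ^ 2))) x := by
  have hc : Continuous fun t : ℝ => Real.exp (-t ^ 2) := by fun_prop
  have h := ((intervalIntegral.integral_hasDerivAt_right (hc.intervalIntegrable 0 x)
    (hc.stronglyMeasurableAtFilter _ _) hc.continuousAt).const_sub
      (∫ t in Set.Ioi (0 : ℝ), Real.exp (-t ^ 2))).const_mul (2 / √Real.pi)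
  rw [mul_neg] at h
  refine h.congr_of_eventuallyEq (Eventually.of_forall fun y => ?_)
  simp only [erfc, integral_Ioi_exp_neg_sq_eq y]

lemma tendsto_erfc_atTop : Tendsto erfc atTop (𝓝 0) := by
  have h : Tendsto (fun x : ℝ => ∫ t in Set.Ioi x, Real.exp (-t ^ 2)) atTop (𝓝 0) := by
    rw [funext integral_Ioi_exp_neg_sq_eq]
    have := intervalIntegral_tendsto_integral_Ioi (0 : ℝ)
      integrable_exp_neg_sq_real.integrableOn tendsto_id
    replace this := this.const_sub (∫ t in Set.Ioi (0 : ℝ), Real.exp (-t ^ 2))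
    rwa [sub_self] at this
  have h' := h.const_mul (2 / √Real.pi)
  rwa [mul_zero] at h'

section Gaussian

variable {a : ℝ} (b : ℝ)

/-- Completing the square in `r²`: `a r⁴ + b r² = (√a r² + b / (2√a))² - b² / (4a)`. The factor `r`
from polar coordinates is, up to a constant, the derivative of the inner function. -/
lemma hasDerivAt_erfc_sq_add (ha : 0 < a) (r : ℝ) :
    HasDerivAt (fun r => -(√Real.pi / (4 * √a) * Real.exp (b ^ 2 / (4 * a)) *
      erfc (√a * r ^ 2 + b / (2 * √a)))) (r * (Real.exp (-(a * r ^ 4)) * Real.exp (-(b * r ^ 2))))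
      r := by
  have ha' : 0 < √a := Real.sqrt_pos.2 ha
  have hpi : 0 < √Real.pi := Real.sqrt_pos.2 Real.pi_pos
  have h1 : HasDerivAt (fun r => √a * r ^ 2 + b / (2 * √a)) (√a * (2 * r)) r := by
    simpa using ((hasDerivAt_pow 2 r).const_mul (√a)).add_const (b / (2 * √a))
  have h := (((hasDerivAt_erfc _).comp r h1).const_mul
    (√Real.pi / (4 * √a) * Real.exp (b ^ 2 / (4 * a)))).neg
  convert! h using 1
  have h2 : Real.exp (-(a * r ^ 4)) * Real.exp (-(b * r ^ 2)) =
      Real.exp (b ^ 2 / (4 * a)) * Real.exp (-(√a * r ^ 2 + b / (2 * √a)) ^ 2) := by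
    rw [← Real.exp_add, ← Real.exp_add]
    congr 1
    have h3 : (√a * r ^ 2 + b / (2 * √a)) ^ 2 = a * r ^ 4 + b * r ^ 2 + b ^ 2 / (4 * a) := by
      have : (√a * r ^ 2 + b / (2 * √a)) ^ 2 =
          √a ^ 2 * r ^ 4 + √a / √a * b * r ^ 2 + b ^ 2 / (4 * √a ^ 2) := by
        field_simp
        ring
      rw [this, Real.sq_sqrt ha.le, div_self ha'.ne', one_mul]
    rw [h3]
    ring
  rw [h2]
  field_simp
  norm_num

lemma tendsto_erfc_sq_add (ha : 0 < a) :
    Tendsto (fun r => -(√Real.pi / (4 * √a) * Real.exp (b ^ 2 / (4 * a)) *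
      erfc (√a * r ^ 2 + b / (2 * √a)))) atTop (𝓝 0) := by
  have h : Tendsto (fun r => √a * r ^ 2 + b / (2 * √a)) atTop atTop :=
    tendsto_atTop_add_const_right _ _
      ((tendsto_pow_atTop two_ne_zero).const_mul_atTop (Real.sqrt_pos.2 ha))
  simpa using ((tendsto_erfc_atTop.comp h).const_mul
    (√Real.pi / (4 * √a) * Real.exp (b ^ 2 / (4 * a)))).neg

lemma integral_plane_exp_mul_exp (ha : 0 < a) :
    ∫ x : Plane, Real.exp (-(a * ‖x‖ ^ 4)) * Real.exp (-(b * ‖x‖ ^ 2)) =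
      2 * Real.pi * (√Real.pi / (4 * √a) * Real.exp (b ^ 2 / (4 * a)) *
        erfc (b / (2 * √a))) := by
  rw [integral_norm_plane (fun r => Real.exp (-(a * r ^ 4)) * Real.exp (-(b * r ^ 2))),
    integral_Ioi_of_hasDerivAt_of_nonneg' (fun r _ => hasDerivAt_erfc_sq_add b ha r)
      (fun r hr => mul_nonneg (le_of_lt hr) (by positivity)) (tendsto_erfc_sq_add b ha)]
  simp

lemma integrable_plane_exp_mul_exp (ha : 0 < a) :
    Integrable fun x : Plane => Real.exp (-(a * ‖x‖ ^ 4)) * Real.exp (-(b * ‖x‖ ^ 2)) := by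
  rw [integrable_norm_plane_iff (f := fun r => Real.exp (-(a * r ^ 4)) * Real.exp (-(b * r ^ 2)))]
  exact integrableOn_Ioi_deriv_of_nonneg
    (hasDerivAt_erfc_sq_add b ha 0).continuousAt.continuousWithinAt
    (fun r _ => hasDerivAt_erfc_sq_add b ha r)
    (fun r hr => mul_nonneg (le_of_lt hr) (by positivity)) (tendsto_erfc_sq_add b ha)

end Gaussian

/-- By `integral_plane_div_add` the inner integral is a multiple of `‖x‖²`, which leaves the
integral of `exp (-a‖x‖⁴ - b‖x‖²)`. The parameter `p` stands for `ρ / M`. -/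
lemma lintegral_plane_discovery {lam p ξ σ : ℝ} (hlam : 0 < lam) (hξ : 0 < ξ)
    (hσ : 0 < σ) :
    ∫⁻ x : Plane, ENNReal.ofReal (lam * Real.exp (-(ξ * σ ^ 2 * ‖x‖ ^ 4)) *
        Real.exp (-(lam * ∫ y : Plane, p * (ξ * ‖x‖ ^ 4 / (‖y‖ ^ 4 + ξ * ‖x‖ ^ 4))))) =
      ENNReal.ofReal (lam * Real.pi ^ (3 / 2 : ℝ) / (2 * √(ξ * σ ^ 2)) *
        Real.exp ((lam * Real.pi ^ 2 * p / (4 * σ)) ^ 2) *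
        erfc (lam * Real.pi ^ 2 * p / (4 * σ))) := by
  set a := ξ * σ ^ 2 with ha
  set b := lam * p * (Real.pi ^ 2 / 2) * √ξ with hb
  have ha0 : 0 < a := by positivity
  have hsa : √a = √ξ * σ := by rw [ha, Real.sqrt_mul hξ.le, Real.sqrt_sq hσ.le]
  have hξ' : 0 < √ξ := Real.sqrt_pos.2 hξ
  have hinner (x : Plane) : ∫ y : Plane, p * (ξ * ‖x‖ ^ 4 / (‖y‖ ^ 4 + ξ * ‖x‖ ^ 4)) =
      p * (Real.pi ^ 2 / 2) * √ξ * ‖x‖ ^ 2 := by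
    rw [integral_const_mul]
    rcases eq_or_ne x 0 with rfl | hx
    · simp
    · have hx' : 0 < ‖x‖ := norm_pos_iff.2 hx
      have h4 : ‖x‖ ^ 4 = (‖x‖ ^ 2) ^ 2 := by ring
      rw [integral_plane_div_add (by positivity), Real.sqrt_mul hξ.le, h4,
        Real.sqrt_sq (by positivity)]
      ring
  have hfun (x : Plane) : lam * Real.exp (-(a * ‖x‖ ^ 4)) *
      Real.exp (-(lam * ∫ y : Plane, p * (ξ * ‖x‖ ^ 4 / (‖y‖ ^ 4 + ξ * ‖x‖ ^ 4)))) =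
      lam * (Real.exp (-(a * ‖x‖ ^ 4)) * Real.exp (-(b * ‖x‖ ^ 2))) := by
    rw [hinner, hb, mul_assoc]
    ring_nf
  simp_rw [hfun]
  rw [← ofReal_integral_eq_lintegral_ofReal ((integrable_plane_exp_mul_exp b ha0).const_mul lam)
    (Eventually.of_forall fun x => by positivity), integral_const_mul,
    integral_plane_exp_mul_exp b ha0]
  have h1 : b / (2 * √a) = lam * Real.pi ^ 2 * p / (4 * σ) := by
    rw [hsa, hb]
    field_simp
    ring
  have h2 : b ^ 2 / (4 * a) = (lam * Real.pi ^ 2 * p / (4 * σ)) ^ 2 := by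
    rw [← h1, div_pow, mul_pow 2, Real.sq_sqrt ha0.le]
    norm_num
  have h3 : Real.pi ^ (3 / 2 : ℝ) = Real.pi * √Real.pi := by
    rw [show (3 / 2 : ℝ) = 1 + 1 / 2 by norm_num, Real.rpow_add Real.pi_pos, Real.rpow_one,
      Real.sqrt_eq_rpow]
  rw [h1, h2, h3]
  congr 1
  ring

/-! ### Sums and products over labelled points -/

lemma ENNReal.measurable_tprod {α : Type*} [MeasurableSpace α] {f : ℕ → α → ℝ≥0∞}
    (hf : ∀ j, Measurable (f j)) (h1 : ∀ j a, f j a ≤ 1) : Measurable fun a => ∏' j, f j a := by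
  refine measurable_of_tendsto_metrizable (f := fun n a => ∏ j ∈ Finset.range n, f j a)
    (fun n => Finset.measurable_prod _ fun j _ => hf j) (tendsto_pi_nhds.2 fun a => ?_)
  exact (ENNReal.multipliable_of_le_one fun j => h1 j a).tendsto_prod_tprod_nat

lemma ENNReal.tprod_le_one {f : ℕ → ℝ≥0∞} (h1 : ∀ j, f j ≤ 1) : ∏' j, f j ≤ 1 := by
  rw [ENNReal.tprod_eq_iInf_prod h1]
  exact (iInf_le _ ∅).trans (by simp)

lemma ENNReal.tsum_ite_const {p : ℕ → Prop} [DecidablePred p] (a : ℝ≥0∞) :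
    ∑' i, (if p i then a else 0) = ({i | p i}.encard : ℝ≥0∞) * a := by
  rw [← ENNReal.tsum_set_const, tsum_subtype {i | p i} fun _ => a]
  simp [Set.indicator_apply]

section Labels

variable {y : ℕ → ℕ} {K k i : ℕ}

/-- Only the finitely many indices with label below `K` have a nontrivial factor. Grouping them by
label gives powers of the `W l`; leaving out `i` lowers the exponent of its own label `k` by one. -/
lemma ENNReal.tprod_labels_ne {W : ℕ → ℝ≥0∞} (hfin : ∀ l < K, {j | y j = l}.Finite)
    (hW : ∀ l, K ≤ l → W l = 1) (hk : k < K) (hi : y i = k) :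
    ∏' j, (if j = i then 1 else W (y j)) =
      ∏ l ∈ Finset.range K, W l ^ ({j | y j = l}.ncard - if l = k then 1 else 0) := by
  classical
  have hJ : {j | y j < K}.Finite := by
    have : {j | y j < K} = ⋃ l ∈ Finset.range K, {j | y j = l} := by ext; simp
    rw [this]
    exact Set.Finite.biUnion (Finset.finite_toSet _) fun l hl => hfin l (by simpa using hl)
  rw [tprod_eq_prod (s := hJ.toFinset.erase i)]
  · calc _ = ∏ j ∈ hJ.toFinset.erase i, W (y j) :=
        Finset.prod_congr rfl fun j hj => if_neg (Finset.ne_of_mem_erase hj)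
      _ = _ := by
        rw [← Finset.prod_fiberwise_of_maps_to' (t := Finset.range K) (g := y) (fun j hj => by
          simpa using (Finset.mem_erase.1 hj).2)]
        refine Finset.prod_congr rfl fun l hl => ?_
        rw [Finset.prod_const]
        congr 1
        have hl' : l < K := by simpa using hl
        have hc : (hJ.toFinset.filter fun j => y j = l).card = {j | y j = l}.ncard := by
          rw [← Set.ncard_coe_finset]
          congr 1
          ext j
          simp only [Finset.coe_filter, Set.Finite.mem_toFinset, Set.mem_ofPred_eq]
          grind
        rw [Finset.filter_erase, ← hc]
        split_ifs with h
        · exact Finset.card_erase_of_mem (by simp [hi, hk, h])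
        · rw [Finset.erase_eq_of_notMem (by simp [hi, Ne.symm h]), Nat.sub_zero]
  · intro j hj
    split_ifs with h
    · rfl
    · exact hW _ (by simpa [h] using hj)

/-- All indices with label `k` contribute the same product, so the sum multiplies it by their
number. The result is a product of functions of the separate label counts, ready for independence.
-/
lemma ENNReal.tsum_tprod_labels_ne {W : ℕ → ℝ≥0∞} (hfin : ∀ l < K, {j | y j = l}.Finite)
    (hW : ∀ l, K ≤ l → W l = 1) (hk : k < K) :
    ∑' i, (if y i = k then ∏' j, (if j = i then 1 else W (y j)) else 0) =
      ∏ l ∈ Finset.range K, ((if l = k then ({j | y j = l}.ncard : ℝ≥0∞) else 1) *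
        W l ^ ({j | y j = l}.ncard - if l = k then 1 else 0)) := by
  have h (i : ℕ) : (if y i = k then ∏' j, (if j = i then 1 else W (y j)) else 0) =
      if y i = k then ∏ l ∈ Finset.range K, W l ^ ({j | y j = l}.ncard - if l = k then 1 else 0)
        else 0 := by
    split_ifs with hi
    · exact ENNReal.tprod_labels_ne hfin hW hk hi
    · rfl
  simp_rw [h]
  rw [ENNReal.tsum_ite_const, Finset.prod_mul_distrib, Finset.prod_ite_eq',
    if_pos (Finset.mem_range.2 hk), ← (hfin k hk).cast_ncard_eq]
  simp

end Labels

/-! ### Generating functions of the Poisson law -/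

section Poisson

variable {μ w : ℝ}

lemma ENNReal.tsum_pow_mul_poisson (hμ : 0 ≤ μ) (hw : 0 ≤ w) :
    ∑' n : ℕ, ENNReal.ofReal w ^ n * poissonMeasure μ.toNNReal {n} =
      ENNReal.ofReal (Real.exp (-(μ * (1 - w)))) := by
  have hs : HasSum (fun n : ℕ => w ^ n * (Real.exp (-μ) * μ ^ n / n.factorial))
      (Real.exp (-(μ * (1 - w)))) := by
    have h := (NormedSpace.expSeries_div_hasSum_exp (w * μ)).mul_left (Real.exp (-μ))
    rw [← Real.exp_eq_exp_ℝ, ← Real.exp_add] at h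
    convert! h using 2
    · rw [mul_pow]; ring
    · ring
  rw [← hs.tsum_eq, ENNReal.ofReal_tsum_of_nonneg (fun n => by positivity) hs.summable]
  refine tsum_congr fun n => ?_
  rw [poissonMeasure_singleton, Real.coe_toNNReal _ hμ, ENNReal.ofReal_mul (by positivity),
    ENNReal.ofReal_pow hw]

/-- Size biasing: `n` times the Poisson mass at `n` is `μ` times the mass at `n - 1`, so a shift of
the index reduces to the generating function. The truncated `n - 1` at `n = 0` is harmless because
of the factor `n`. -/
lemma ENNReal.tsum_nat_mul_pow_mul_poisson (hμ : 0 ≤ μ) (hw : 0 ≤ w) :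
    ∑' n : ℕ, (n * ENNReal.ofReal w ^ (n - 1)) * poissonMeasure μ.toNNReal {n} =
      ENNReal.ofReal (μ * Real.exp (-(μ * (1 - w)))) := by
  rw [ENNReal.ofReal_mul hμ, ← ENNReal.tsum_pow_mul_poisson hμ hw, ← ENNReal.tsum_mul_left,
    tsum_eq_zero_add' ENNReal.summable]
  simp only [Nat.cast_zero, zero_mul, zero_add, Nat.add_sub_cancel]
  refine tsum_congr fun n => ?_
  have : ((n + 1 : ℕ) : ℝ≥0∞) * poissonMeasure μ.toNNReal {n + 1} =
      ENNReal.ofReal μ * poissonMeasure μ.toNNReal {n} := by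
    rw [poissonMeasure_singleton, poissonMeasure_singleton, Real.coe_toNNReal _ hμ,
      ← ENNReal.ofReal_natCast, ← ENNReal.ofReal_mul (by positivity),
      ← ENNReal.ofReal_mul hμ, Nat.factorial_succ]
    congr 1
    push_cast
    field_simp
    ring
  rw [mul_right_comm, this]
  ring

end Poisson

/-! ### Counts of the Poisson process in finitely many cells -/

namespace IsHomogeneousPPP

variable {Ω : Type*} [MeasurableSpace Ω] {P : Measure Ω} {lam : ℝ} {X : ℕ → Ω → Plane}

lemma measurable_pointCount (hX : IsHomogeneousPPP P lam X) {A : Set Plane}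
    (hA : MeasurableSet A) : Measurable (pointCount X A) :=
  measurable_encard.comp (measurable_set_iff.2 fun i =>
    measurableSet_setOfPred.1 (hX.measurable i hA))

variable [IsProbabilityMeasure P]

/-- The hypothesis fixes only the probabilities of finite counts. These already sum to one, so no
mass is left for `⊤`: the Poisson law is dominated by the law of the count, and two probability
measures so ordered coincide. -/
lemma map_pointCount (hX : IsHomogeneousPPP P lam X) {A : Set Plane}
    (hA : MeasurableSet A) (hA' : volume A ≠ ∞) :
    P.map (pointCount X A) =
      (poissonMeasure (lam * volume.real A).toNNReal).map (Nat.cast : ℕ → ℕ∞) := by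
  have hm := hX.measurable_pointCount hA
  have hc : Measurable (Nat.cast : ℕ → ℕ∞) := Measurable.of_discrete
  have : IsProbabilityMeasure (P.map (pointCount X A)) :=
    Measure.isProbabilityMeasure_map hm.aemeasurable
  have : IsProbabilityMeasure
      ((poissonMeasure (lam * volume.real A).toNNReal).map (Nat.cast : ℕ → ℕ∞)) :=
    Measure.isProbabilityMeasure_map hc.aemeasurable
  symm
  refine Measure.eq_of_le_of_isProbabilityMeasure ?_
  refine Measure.le_iff.2 fun s hs => ?_
  rw [Measure.map_apply hc hs, Measure.map_apply hm hs]
  calc poissonMeasure _ (Nat.cast ⁻¹' s)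
      = ∑' n : (Nat.cast ⁻¹' s : Set ℕ), poissonMeasure (lam * volume.real A).toNNReal {n.1} := by
        rw [← measure_biUnion (f := fun n => {n}) (Set.to_countable _)
          (fun i _ j _ hij => by simpa [Function.onFun] using hij) (fun _ _ => .singleton _),
          Set.biUnion_of_singleton]
    _ = ∑' n : (Nat.cast ⁻¹' s : Set ℕ), P (pointCount X A ⁻¹' {(n.1 : ℕ∞)}) :=
        tsum_congr fun n => (hX.count_law A hA hA' n.1).symm
    _ = P (⋃ n ∈ (Nat.cast ⁻¹' s : Set ℕ), pointCount X A ⁻¹' {(n : ℕ∞)}) := by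
        rw [measure_biUnion (Set.to_countable _) _ (fun _ _ => hm (.singleton _))]
        intro i _ j _ hij
        exact Disjoint.preimage _ (by simpa using hij)
    _ ≤ P (pointCount X A ⁻¹' s) := by
        refine measure_mono (Set.iUnion₂_subset fun n hn => Set.preimage_mono ?_)
        simpa using hn

lemma lintegral_pointCount (hX : IsHomogeneousPPP P lam X) {A : Set Plane}
    (hA : MeasurableSet A) (hA' : volume A ≠ ∞) (φ : ℕ∞ → ℝ≥0∞) :
    ∫⁻ ω, φ (pointCount X A ω) ∂P =
      ∑' n : ℕ, φ n * poissonMeasure (lam * volume.real A).toNNReal {n} := by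
  rw [← lintegral_map (f := φ) Measurable.of_discrete (hX.measurable_pointCount hA),
    hX.map_pointCount hA hA', lintegral_map Measurable.of_discrete Measurable.of_discrete,
    lintegral_countable']

lemma ae_finite (hX : IsHomogeneousPPP P lam X) {A : Set Plane}
    (hA : MeasurableSet A) (hA' : volume A ≠ ∞) : ∀ᵐ ω ∂P, {i | X i ω ∈ A}.Finite := by
  have h : ∀ᵐ n ∂(P.map (pointCount X A)), n ≠ ⊤ := by
    rw [hX.map_pointCount hA hA', ae_map_iff Measurable.of_discrete.aemeasurable .of_discrete]
    exact Eventually.of_forall fun n => ENat.natCast_ne_top n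
  filter_upwards [ae_of_ae_map (hX.measurable_pointCount hA).aemeasurable h] with ω hω
  exact Set.encard_ne_top_iff.1 hω

section Cells

variable {c : Plane → ℕ} {K : ℕ}

/-- The functional depends only on the counts in the cells, which are independent. Cell `k`
contributes the size-biased generating function, hence the prefactor, and every other cell the
ordinary one; the exponents add up. -/
lemma lintegral_tsum_tprod_cell (hX : IsHomogeneousPPP P lam X) (hlam : 0 ≤ lam)
    (hc : Measurable c) (hK : ∀ l < K, volume (c ⁻¹' {l}) ≠ ∞) {W : ℕ → ℝ} (hW0 : ∀ l, 0 ≤ W l)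
    (hW : ∀ l, K ≤ l → W l = 1) {k : ℕ} (hk : k < K) :
    ∫⁻ ω, ∑' i, (if c (X i ω) = k then
        ∏' j, (if j = i then 1 else ENNReal.ofReal (W (c (X j ω)))) else 0) ∂P =
      ENNReal.ofReal (lam * volume.real (c ⁻¹' {k}) * Real.exp
        (-(lam * ∑ l ∈ Finset.range K, volume.real (c ⁻¹' {l}) * (1 - W l)))) := by
  have hA (l : ℕ) : MeasurableSet (c ⁻¹' {l}) := hc (.singleton l)
  have hfin : ∀ᵐ ω ∂P, ∀ l, l < K → {i | c (X i ω) = l}.Finite := by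
    refine ae_all_iff.2 fun l => ?_
    by_cases hl : l < K
    · filter_upwards [hX.ae_finite (hA l) (hK l hl)] with ω hω _ using hω
    · exact Eventually.of_forall fun ω h => absurd h hl
  let φ (l : ℕ) (n : ℕ∞) : ℝ≥0∞ := (if l = k then (n.toNat : ℝ≥0∞) else 1) *
    ENNReal.ofReal (W l) ^ (n.toNat - if l = k then 1 else 0)
  have hφ (l : ℕ) (hl : l < K) : ∫⁻ ω, φ l (pointCount X (c ⁻¹' {l}) ω) ∂P =
      (if l = k then ENNReal.ofReal (lam * volume.real (c ⁻¹' {k})) else 1) *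
        ENNReal.ofReal (Real.exp (-(lam * volume.real (c ⁻¹' {l}) * (1 - W l)))) := by
    have hμ : 0 ≤ lam * volume.real (c ⁻¹' {l}) := by positivity
    rw [hX.lintegral_pointCount (hA l) (hK l hl)]
    by_cases h : l = k
    · subst h
      simp only [φ, if_true, ENat.toNat_natCast]
      rw [← ENNReal.ofReal_mul hμ, ← ENNReal.tsum_nat_mul_pow_mul_poisson hμ (hW0 l)]
    · simp only [φ, if_neg h, ENat.toNat_natCast, one_mul, Nat.sub_zero]
      exact ENNReal.tsum_pow_mul_poisson hμ (hW0 l)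
  calc _ = ∫⁻ ω, ∏ l : Fin K, φ l (pointCount X (c ⁻¹' {(l : ℕ)}) ω) ∂P := by
        refine lintegral_congr_ae ?_
        filter_upwards [hfin] with ω hω
        rw [ENNReal.tsum_tprod_labels_ne (y := fun j => c (X j ω))
          (W := fun l => ENNReal.ofReal (W l)) hω
          (fun l hl => by simp [hW l hl]) hk, Finset.prod_range]
        rfl
    _ = ∏ l : Fin K, ∫⁻ ω, φ l (pointCount X (c ⁻¹' {(l : ℕ)}) ω) ∂P := by
        refine lintegral_prod_eq_prod_lintegral_of_indepFun Finset.univ _ ?_ fun l =>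
          (Measurable.of_discrete (f := φ l)).comp (hX.measurable_pointCount (hA l))
        refine (hX.count_indep K (fun l => c ⁻¹' {(l : ℕ)}) (fun l => hA l) (fun l => hK l l.2)
          fun l l' h => Disjoint.preimage _ ?_).comp (fun l => φ l) fun l => Measurable.of_discrete
        simpa [Fin.ext_iff] using h
    _ = ∏ l ∈ Finset.range K, ((if l = k then ENNReal.ofReal (lam * volume.real (c ⁻¹' {k})) else 1)
        * ENNReal.ofReal (Real.exp (-(lam * volume.real (c ⁻¹' {l}) * (1 - W l))))) := by
        rw [Finset.prod_range]
        exact Finset.prod_congr rfl fun l _ => hφ l l.2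
    _ = _ := by
        rw [Finset.prod_mul_distrib, Finset.prod_ite_eq', if_pos (Finset.mem_range.2 hk),
          ← ENNReal.ofReal_prod_of_nonneg (fun _ _ => (Real.exp_pos _).le), ← Real.exp_sum,
          ← ENNReal.ofReal_mul (by positivity), Finset.sum_neg_distrib, Finset.mul_sum]
        simp only [mul_assoc]

end Cells

end IsHomogeneousPPP

/-! ### The Mecke formula for finitely many labels -/

section LabelIntegral

variable {c : Plane → ℕ} {K : ℕ}

lemma integral_comp_label (hc : Measurable c) (hK : ∀ l < K, volume (c ⁻¹' {l}) ≠ ∞)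
    {G : ℕ → ℝ} (hG : ∀ l, K ≤ l → G l = 0) :
    ∫ y, G (c y) = ∑ l ∈ Finset.range K, volume.real (c ⁻¹' {l}) * G l := by
  have h (y : Plane) : G (c y) =
      ∑ l ∈ Finset.range K, (c ⁻¹' {l}).indicator (fun _ => G l) y := by
    classical
    simp only [Set.indicator_apply, Set.mem_preimage, Set.mem_singleton_iff, Finset.sum_ite_eq,
      Finset.mem_range]
    split_ifs with h
    · rfl
    · exact hG _ (not_lt.1 h)
  rw [integral_congr_ae (Eventually.of_forall h)]
  rw [integral_finsetSum _ fun l hl => (integrable_indicator_iff (hc (.singleton l))).2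
    (integrableOn_const (hK l (Finset.mem_range.1 hl)))]
  refine Finset.sum_congr rfl fun l _ => ?_
  rw [integral_indicator_const _ (hc (.singleton l)), smul_eq_mul]

lemma lintegral_comp_label (hc : Measurable c) {G : ℕ → ℝ≥0∞} (hG : ∀ l, K ≤ l → G l = 0) :
    ∫⁻ y, G (c y) = ∑ l ∈ Finset.range K, G l * volume (c ⁻¹' {l}) := by
  have h (y : Plane) : G (c y) =
      ∑ l ∈ Finset.range K, (c ⁻¹' {l}).indicator (fun _ => G l) y := by
    classical
    simp only [Set.indicator_apply, Set.mem_preimage, Set.mem_singleton_iff, Finset.sum_ite_eq,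
      Finset.mem_range]
    split_ifs with h
    · rfl
    · exact hG _ (not_lt.1 h)
  rw [lintegral_congr h]
  rw [lintegral_finsetSum _ fun l _ => measurable_const.indicator (hc (.singleton l))]
  refine Finset.sum_congr rfl fun l _ => ?_
  rw [lintegral_indicator_const (hc (.singleton l))]

end LabelIntegral

namespace IsHomogeneousPPP

variable {Ω : Type*} [MeasurableSpace Ω] {P : Measure Ω} [IsProbabilityMeasure P] {lam : ℝ}
  {X : ℕ → Ω → Plane} {c : Plane → ℕ} {K : ℕ}

/-- Product form of the Mecke formula for functions of a label with finitely many relevant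
values. -/
lemma lintegral_tsum_tprod_label (hX : IsHomogeneousPPP P lam X) (hlam : 0 ≤ lam)
    (hc : Measurable c) (hK : ∀ l < K, volume (c ⁻¹' {l}) ≠ ∞) {F : ℕ → ℝ} {V : ℕ → ℕ → ℝ}
    (hF0 : ∀ k, 0 ≤ F k) (hF : ∀ k, K ≤ k → F k = 0) (hV0 : ∀ k l, 0 ≤ V k l)
    (hV1 : ∀ k l, V k l ≤ 1) (hV : ∀ k l, K ≤ l → V k l = 1) :
    ∫⁻ ω, ∑' i, ENNReal.ofReal (F (c (X i ω))) *
        ∏' j, (if j = i then 1 else ENNReal.ofReal (V (c (X i ω)) (c (X j ω)))) ∂P =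
      ∫⁻ x, ENNReal.ofReal (lam * F (c x) *
        Real.exp (-(lam * ∫ y, (1 - V (c x) (c y))))) := by
  have hcX (j : ℕ) : Measurable fun ω => c (X j ω) := hc.comp (hX.measurable j)
  have hmeas (k : ℕ) : Measurable fun ω => ∑' i, (if c (X i ω) = k then
      ∏' j, (if j = i then 1 else ENNReal.ofReal (V k (c (X j ω)))) else 0) := by
    refine Measurable.tsum fun i => Measurable.ite (hcX i (.singleton k)) ?_
      measurable_const
    refine ENNReal.measurable_tprod (fun j => ?_) fun j ω => ?_
    · split_ifs
      · exact measurable_const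
      · exact (Measurable.of_discrete (f := fun l => ENNReal.ofReal (V k l))).comp (hcX j)
    · split_ifs
      · exact le_rfl
      · simpa using hV1 _ _
  -- Sort the points `i` by label, so that the first argument of `V` becomes a constant `k`; labels
  -- from `K` on drop out because `F` vanishes there.
  have hsplit (ω : Ω) : ∑' i, ENNReal.ofReal (F (c (X i ω))) *
        ∏' j, (if j = i then 1 else ENNReal.ofReal (V (c (X i ω)) (c (X j ω)))) =
      ∑ k ∈ Finset.range K, ENNReal.ofReal (F k) * ∑' i, (if c (X i ω) = k then
        ∏' j, (if j = i then 1 else ENNReal.ofReal (V k (c (X j ω)))) else 0) := by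
    simp_rw [← ENNReal.tsum_mul_left]
    rw [← Summable.tsum_finsetSum fun _ _ => ENNReal.summable]
    refine tsum_congr fun i => ?_
    simp only [mul_ite, mul_zero, Finset.sum_ite_eq, Finset.mem_range]
    split_ifs with h
    · rfl
    · simp [hF _ (not_lt.1 h)]
  simp_rw [hsplit]
  rw [lintegral_finsetSum _ fun k _ => (hmeas k).const_mul _,
    lintegral_comp_label (K := K) hc (G := fun k => ENNReal.ofReal (lam * F k *
        Real.exp (-(lam * ∫ y, (1 - V k (c y)))))) (fun l hl => by simp [hF l hl])]
  refine Finset.sum_congr rfl fun k hk => ?_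
  have hk' := Finset.mem_range.1 hk
  rw [lintegral_const_mul _ (hmeas k), hX.lintegral_tsum_tprod_cell hlam hc hK (hV0 k) (hV k) hk',
    integral_comp_label (G := fun l => 1 - V k l) hc hK (fun l hl => by simp [hV k l hl]),
    ← ENNReal.ofReal_toReal (hK k hk'), ← ENNReal.ofReal_mul (hF0 k),
    ← ENNReal.ofReal_mul (mul_nonneg (mul_nonneg hlam (hF0 k)) (Real.exp_pos _).le)]
  congr 1
  simp only [Measure.real]
  ring

end IsHomogeneousPPP

/-- Dominated convergence for infinite products of factors in the unit interval. -/
lemma ENNReal.tendsto_tprod_ofReal {w : ℕ → ℕ → ℝ} {w' bound : ℕ → ℝ} (hb : Summable bound)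
    (hw : ∀ j, Tendsto (w · j) atTop (𝓝 (w' j))) (h0 : ∀ n j, 0 ≤ w n j) (h1 : ∀ n j, w n j ≤ 1)
    (hwb : ∀ n j, 1 - w n j ≤ bound j) :
    Tendsto (fun n => ∏' j, ENNReal.ofReal (w n j)) atTop
      (𝓝 (∏' j, ENNReal.ofReal (w' j))) := by
  -- The summable bound makes the real product `∏ (1 + (u j - 1))` converge absolutely, so the
  -- question moves from `[0, ∞]` to real products.
  have key {u : ℕ → ℝ} (hu0 : ∀ j, 0 ≤ u j) (hu1 : ∀ j, u j ≤ 1) (hub : ∀ j, 1 - u j ≤ bound j) :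
      ∏' j, ENNReal.ofReal (u j) = ENNReal.ofReal (∏' j, (1 + (u j - 1))) := by
    have hs : Summable fun j => ‖u j - 1‖ := hb.of_nonneg_of_le (fun j => norm_nonneg _) fun j => by
      rw [Real.norm_eq_abs, abs_sub_comm, abs_of_nonneg (sub_nonneg.2 (hu1 j))]
      exact hub j
    have hm : HasProd (fun j => 1 + (u j - 1)) _ := (multipliable_one_add_of_summable hs).hasProd
    refine HasProd.tprod_eq ?_
    have ht := (ENNReal.continuous_ofReal.tendsto _).comp hm
    refine ht.congr fun s => ?_
    simp only [Function.comp, add_sub_cancel]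
    exact ENNReal.ofReal_prod_of_nonneg fun j _ => hu0 j
  have h0' (j : ℕ) : 0 ≤ w' j := ge_of_tendsto' (hw j) fun n => h0 n j
  have h1' (j : ℕ) : w' j ≤ 1 := le_of_tendsto' (hw j) fun n => h1 n j
  have hb' (j : ℕ) : 1 - w' j ≤ bound j := le_of_tendsto' ((hw j).const_sub 1) fun n => hwb n j
  rw [key h0' h1' hb', funext fun n => key (h0 n) (h1 n) (hwb n)]
  refine (ENNReal.continuous_ofReal.tendsto _).comp
    (tendsto_tprod_one_add_of_dominated_convergence hb (fun j => (hw j).sub_const 1)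
      (Eventually.of_forall fun n j => ?_))
  rw [Real.norm_eq_abs, abs_sub_comm, abs_of_nonneg (sub_nonneg.2 (h1 n j))]
  exact hwb n j

/-! ### Intensity measure and the Mecke formula for radial functions -/

namespace IsHomogeneousPPP

variable {Ω : Type*} [MeasurableSpace Ω] {P : Measure Ω} [IsProbabilityMeasure P] {lam : ℝ}
  {X : ℕ → Ω → Plane}

/-- The intensity measure of a homogeneous Poisson point process. -/
lemma sum_map (hX : IsHomogeneousPPP P lam X) (hlam : 0 ≤ lam) :
    Measure.sum (fun i => P.map (X i)) = ENNReal.ofReal lam • volume := by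
  have hfin {A : Set Plane} (hA : MeasurableSet A) (hA' : volume A ≠ ∞) :
      Measure.sum (fun i => P.map (X i)) A = (ENNReal.ofReal lam • volume) A := by
    rw [Measure.sum_apply _ hA]
    have h1 : ∫⁻ ω, ENat.toENNReal (pointCount X A ω) ∂P =
        ENNReal.ofReal (lam * volume.real A) := by
      rw [hX.lintegral_pointCount hA hA']
      have := ENNReal.tsum_nat_mul_pow_mul_poisson (μ := lam * volume.real A) (w := 1)
        (by positivity) zero_le_one
      simpa using this
    have h2 (ω : Ω) : ENat.toENNReal (pointCount X A ω) =
        ∑' i, (X i ⁻¹' A).indicator (fun _ => 1) ω := by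
      classical
      have := ENNReal.tsum_ite_const (p := fun i => X i ω ∈ A) 1
      rw [mul_one] at this
      rw [pointCount, ← this]
      rfl
    simp_rw [h2] at h1
    rw [lintegral_tsum fun i =>
      (measurable_const.indicator (hX.measurable i hA)).aemeasurable] at h1
    simp only [lintegral_indicator_const (hX.measurable _ hA), one_mul] at h1
    simp only [Measure.map_apply (hX.measurable _) hA, h1, Measure.smul_apply, smul_eq_mul]
    rw [ENNReal.ofReal_mul hlam, Measure.real, ENNReal.ofReal_toReal hA']
  ext A hA
  -- The Poisson law is available only for sets of finite area, so a general set is exhausted by its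
  -- intersections with balls.
  have hU : A = ⋃ n : ℕ, A ∩ Metric.ball 0 n := by
    rw [← Set.inter_iUnion, Metric.iUnion_ball_nat, Set.inter_univ]
  have hmono : Monotone fun n : ℕ => A ∩ Metric.ball (0 : Plane) n := fun m n h =>
    Set.inter_subset_inter_right _ (Metric.ball_subset_ball (by exact_mod_cast h))
  rw [hU, hmono.measure_iUnion, hmono.measure_iUnion]
  refine iSup_congr fun n => hfin (hA.inter measurableSet_ball) ?_
  exact ((measure_mono Set.inter_subset_right).trans_lt measure_ball_lt_top).ne

/-- Campbell's formula, read off the intensity measure. It supplies the dominating bounds for the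
passage to the limit. -/
lemma lintegral_tsum (hX : IsHomogeneousPPP P lam X) (hlam : 0 ≤ lam) {g : Plane → ℝ≥0∞}
    (hg : Measurable g) :
    ∫⁻ ω, ∑' i, g (X i ω) ∂P = ENNReal.ofReal lam * ∫⁻ x, g x := by
  rw [← smul_eq_mul, ← lintegral_smul_measure, ← hX.sum_map hlam, lintegral_sum_measure,
    MeasureTheory.lintegral_tsum (f := fun i ω => g (X i ω))
      fun i => (hg.comp (hX.measurable i)).aemeasurable]
  exact tsum_congr fun i => (lintegral_map hg (hX.measurable i)).symm

/-- The origin is a null set for the intensity measure. Almost surely this avoids the singularity of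
the path loss, and continuity is needed only at positive radii. -/
lemma ae_ne_zero (hX : IsHomogeneousPPP P lam X) (hlam : 0 ≤ lam) :
    ∀ᵐ ω ∂P, ∀ i, X i ω ≠ 0 := by
  have h : Measure.sum (fun i => P.map (X i)) {0} = 0 := by rw [hX.sum_map hlam]; simp
  rw [Measure.sum_apply _ (.singleton _), ENNReal.tsum_eq_zero] at h
  refine ae_all_iff.2 fun i => ?_
  have hi := h i
  rw [Measure.map_apply (hX.measurable i) (.singleton _)] at hi
  rw [ae_iff]
  simp only [ne_eq, not_not]
  exact hi

end IsHomogeneousPPP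

section Radius

/-- The index of the annulus of width `2⁻ⁿ` that contains `x`. -/
noncomputable def annulus (n : ℕ) (x : Plane) : ℕ := ⌊‖x‖ * 2 ^ n⌋₊

/-- The inner radius of the annulus of width `2⁻ⁿ` that contains `x`. -/
noncomputable def innerRadius (n : ℕ) (x : Plane) : ℝ := annulus n x / 2 ^ n

lemma measurable_annulus (n : ℕ) : Measurable (annulus n) :=
  Nat.measurable_floor.comp (measurable_norm.mul_const _)

lemma volume_annulus_ne_top (n l : ℕ) : volume (annulus n ⁻¹' {l}) ≠ ∞ := by
  refine ((measure_mono fun x hx => ?_).trans_lt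
    (measure_ball_lt_top (x := (0 : Plane)) (r := l + 1))).ne
  have h : annulus n x = l := hx
  rw [mem_ball_zero_iff, ← h]
  exact (le_mul_of_one_le_right (norm_nonneg x) (one_le_pow₀ one_le_two)).trans_lt
    (Nat.lt_floor_add_one _)

lemma innerRadius_nonneg (n : ℕ) (x : Plane) : 0 ≤ innerRadius n x := by
  unfold innerRadius; positivity

lemma innerRadius_le (n : ℕ) (x : Plane) : innerRadius n x ≤ ‖x‖ := by
  rw [innerRadius, div_le_iff₀ (by positivity)]
  exact Nat.floor_le (by positivity)

lemma norm_sub_one_le_innerRadius (n : ℕ) (x : Plane) : ‖x‖ - 1 ≤ innerRadius n x := by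
  have h2 : (1 : ℝ) ≤ 2 ^ n := one_le_pow₀ one_le_two
  rw [innerRadius, le_div_iff₀ (by positivity)]
  have := (Nat.lt_floor_add_one (‖x‖ * 2 ^ n)).le
  simp only [annulus]
  linarith

lemma tendsto_innerRadius (x : Plane) : Tendsto (innerRadius · x) atTop (𝓝 ‖x‖) :=
  (tendsto_nat_floor_mul_div_atTop (norm_nonneg x)).comp
    (tendsto_pow_atTop_atTop_of_one_lt one_lt_two)

lemma eventually_annulus_lt (x : Plane) : ∀ᶠ n in atTop, annulus n x < 4 ^ n := by
  filter_upwards [(tendsto_pow_atTop_atTop_of_one_lt (one_lt_two (α := ℝ))).eventually_gt_atTop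
    ‖x‖] with n hn
  rw [annulus, Nat.floor_lt (by positivity)]
  push_cast
  rw [show (4 : ℝ) = 2 * 2 by norm_num, mul_pow]
  gcongr

end Radius

namespace IsHomogeneousPPP

variable {Ω : Type*} [MeasurableSpace Ω] {P : Measure Ω} [IsProbabilityMeasure P] {lam : ℝ}
  {X : ℕ → Ω → Plane}

/-- Product form of the Mecke formula for radial functions. -/
theorem lintegral_tsum_tprod_radial (hX : IsHomogeneousPPP P lam X) (hlam : 0 ≤ lam)
    {f : ℝ → ℝ} {v : ℝ → ℝ → ℝ} {D : Plane → ℝ} (hDm : Measurable D) (hD : Integrable D)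
    (hD0 : ∀ x, 0 ≤ D x)
    (hf0 : ∀ r, 0 ≤ f r) (hfc : ∀ r, 0 < r → ContinuousAt f r)
    (hfb : ∃ C, ∀ x r, 0 ≤ r → ‖x‖ - 1 ≤ r → r ≤ ‖x‖ → f r ≤ C * D x)
    (hv0 : ∀ r t, 0 ≤ v r t) (hv1 : ∀ r t, v r t ≤ 1)
    (hvc : ∀ r t, 0 < r → 0 < t → ContinuousAt (fun z : ℝ × ℝ => v z.1 z.2) (r, t))
    (hvb : ∀ x : Plane, x ≠ 0 → ∃ C, ∀ y r t, 0 ≤ r → r ≤ ‖x‖ → 0 ≤ t → ‖y‖ - 1 ≤ t → t ≤ ‖y‖ →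
      1 - v r t ≤ C * D y) :
    ∫⁻ ω, ∑' i, ENNReal.ofReal (f ‖X i ω‖) *
        ∏' j, (if j = i then 1 else ENNReal.ofReal (v ‖X i ω‖ ‖X j ω‖)) ∂P =
      ∫⁻ x : Plane, ENNReal.ofReal (lam * f ‖x‖ *
        Real.exp (-(lam * ∫ y : Plane, (1 - v ‖x‖ ‖y‖)))) := by
  obtain ⟨C, hC⟩ := hfb
  have hCD (x : Plane) : 0 ≤ C * D x :=
    (hf0 ‖x‖).trans (hC x ‖x‖ (norm_nonneg x) (by linarith) le_rfl)
  -- Evaluate `f` and `v` at inner radii and keep only the `4 ^ n` annuli of width `2⁻ⁿ` within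
  -- radius `2 ^ n`. The default values 0 and 1 make points farther out invisible, so finitely many
  -- labels matter.
  let F (n k : ℕ) : ℝ := if k < 4 ^ n then f (k / 2 ^ n) else 0
  let V (n k l : ℕ) : ℝ := if l < 4 ^ n then v (k / 2 ^ n) (l / 2 ^ n) else 1
  have hF0 (n k) : 0 ≤ F n k := by simp only [F]; split_ifs; exacts [hf0 _, le_rfl]
  have hV0 (n k l) : 0 ≤ V n k l := by simp only [V]; split_ifs; exacts [hv0 _ _, zero_le_one]
  have hV1 (n k l) : V n k l ≤ 1 := by simp only [V]; split_ifs; exacts [hv1 _ _, le_rfl]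
  have hFb (n x) : F n (annulus n x) ≤ C * D x := by
    simp only [F]
    split_ifs
    · exact hC x _ (innerRadius_nonneg n x) (norm_sub_one_le_innerRadius n x) (innerRadius_le n x)
    · exact hCD x
  have hVb (x : Plane) (hx : x ≠ 0) :
      ∃ C', ∀ n y, 1 - V n (annulus n x) (annulus n y) ≤ C' * D y := by
    obtain ⟨C', hC'⟩ := hvb x hx
    refine ⟨C', fun n y => ?_⟩
    have h := hC' y _ _ (innerRadius_nonneg n x) (innerRadius_le n x) (innerRadius_nonneg n y)
      (norm_sub_one_le_innerRadius n y) (innerRadius_le n y)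
    simp only [V]
    split_ifs
    · exact h
    · rw [sub_self]
      exact (sub_nonneg.2 (hv1 _ _)).trans h
  have hFlim (x : Plane) (hx : x ≠ 0) :
      Tendsto (fun n => F n (annulus n x)) atTop (𝓝 (f ‖x‖)) := by
    refine ((hfc _ (norm_pos_iff.2 hx)).tendsto.comp (tendsto_innerRadius x)).congr' ?_
    filter_upwards [eventually_annulus_lt x] with n hn
    simp [F, hn, innerRadius]
  have hVlim (x y : Plane) (hx : x ≠ 0) (hy : y ≠ 0) :
      Tendsto (fun n => V n (annulus n x) (annulus n y)) atTop (𝓝 (v ‖x‖ ‖y‖)) := by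
    refine ((hvc _ _ (norm_pos_iff.2 hx) (norm_pos_iff.2 hy)).tendsto.comp
      ((tendsto_innerRadius x).prodMk_nhds (tendsto_innerRadius y))).congr' ?_
    filter_upwards [eventually_annulus_lt y] with n hn
    simp [V, hn, innerRadius]
  have hstep (n : ℕ) := hX.lintegral_tsum_tprod_label hlam (measurable_annulus n) (K := 4 ^ n)
    (fun l _ => volume_annulus_ne_top n l) (F := F n) (V := V n) (hF0 n)
    (fun k hk => if_neg (not_lt.2 hk)) (hV0 n) (hV1 n) (fun k l hl => if_neg (not_lt.2 hl))
  have hannX (n j) : Measurable fun ω => annulus n (X j ω) :=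
    (measurable_annulus n).comp (hX.measurable j)
  have hprod1 (n i ω) : ∏' j, (if j = i then 1 else
      ENNReal.ofReal (V n (annulus n (X i ω)) (annulus n (X j ω)))) ≤ 1 := by
    refine ENNReal.tprod_le_one fun j => ?_
    split_ifs
    · exact le_rfl
    · simpa using hV1 _ _ _
  have hterm (n i ω) : ENNReal.ofReal (F n (annulus n (X i ω))) * ∏' j, (if j = i then 1 else
      ENNReal.ofReal (V n (annulus n (X i ω)) (annulus n (X j ω)))) ≤
        ENNReal.ofReal (C * D (X i ω)) :=
    (mul_le_of_le_one_right' (hprod1 n i ω)).trans (ENNReal.ofReal_le_ofReal (hFb n _))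
  have hbm : Measurable fun x => ENNReal.ofReal (C * D x) := (hDm.const_mul C).ennreal_ofReal
  have hint : ∫⁻ ω, ∑' i, ENNReal.ofReal (C * D (X i ω)) ∂P ≠ ∞ := by
    rw [hX.lintegral_tsum hlam (g := fun x => ENNReal.ofReal (C * D x)) hbm]
    exact ENNReal.mul_ne_top ENNReal.ofReal_ne_top (hD.const_mul C).lintegral_lt_top.ne
  -- The mean of this sum is finite by Campbell's formula, so the sum is finite almost surely. It
  -- then dominates the products over `j` for all `i` simultaneously.
  have hDsum : ∀ᵐ ω ∂P, Summable fun i => D (X i ω) := by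
    have h : ∫⁻ ω, ∑' i, ENNReal.ofReal (D (X i ω)) ∂P ≠ ∞ := by
      rw [hX.lintegral_tsum hlam (g := fun x => ENNReal.ofReal (D x)) hDm.ennreal_ofReal]
      exact ENNReal.mul_ne_top ENNReal.ofReal_ne_top hD.lintegral_lt_top.ne
    filter_upwards [ae_lt_top (Measurable.tsum fun i =>
      hDm.ennreal_ofReal.comp (hX.measurable i)) h] with ω hω
    have := ENNReal.summable_toReal hω.ne
    simpa [ENNReal.toReal_ofReal (hD0 _)] using this
  have hbsum : ∀ᵐ ω ∂P, ∑' i, ENNReal.ofReal (C * D (X i ω)) ≠ ∞ := by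
    filter_upwards [hDsum] with ω hω
    exact (hω.mul_left C).tsum_ofReal_ne_top
  have hleft : Tendsto (fun n => ∫⁻ ω, ∑' i, ENNReal.ofReal (F n (annulus n (X i ω))) *
      ∏' j, (if j = i then 1 else
        ENNReal.ofReal (V n (annulus n (X i ω)) (annulus n (X j ω)))) ∂P) atTop
      (𝓝 (∫⁻ ω, ∑' i, ENNReal.ofReal (f ‖X i ω‖) *
        ∏' j, (if j = i then 1 else ENNReal.ofReal (v ‖X i ω‖ ‖X j ω‖)) ∂P)) := by
    refine tendsto_lintegral_of_dominated_convergence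
      (fun ω => ∑' i, ENNReal.ofReal (C * D (X i ω))) (fun n => ?_)
      (fun n => Eventually.of_forall fun ω => ENNReal.tsum_le_tsum fun i => hterm n i ω) hint ?_
    · refine Measurable.tsum fun i => Measurable.mul ?_ (ENNReal.measurable_tprod (fun j => ?_) ?_)
      · exact (Measurable.of_discrete (f := fun k => ENNReal.ofReal (F n k))).comp (hannX n i)
      · split_ifs
        · exact measurable_const
        · exact (Measurable.of_discrete (f := fun p : ℕ × ℕ => ENNReal.ofReal (V n p.1 p.2))).comp
            ((hannX n i).prodMk (hannX n j))
      · intro j ω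
        split_ifs
        · exact le_rfl
        · simpa using hV1 _ _ _
    · filter_upwards [hX.ae_ne_zero hlam, hDsum, hbsum] with ω h0 hs hb
      -- The sum over `i` is an integral for counting measure, so dominated convergence applies a
      -- second time, now for a fixed outcome.
      simp_rw [← lintegral_count] at hb ⊢
      refine tendsto_lintegral_of_dominated_convergence _ (fun n => Measurable.of_discrete)
        (fun n => Eventually.of_forall fun i => hterm n i ω) hb (Eventually.of_forall fun i => ?_)
      refine ENNReal.Tendsto.mul
        ((ENNReal.continuous_ofReal.tendsto _).comp (hFlim _ (h0 i))) (Or.inr ?_) ?_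
        (Or.inr ENNReal.ofReal_ne_top)
      · refine ((ENNReal.tprod_le_one fun j => ?_).trans_lt ENNReal.one_lt_top).ne
        split_ifs
        · exact le_rfl
        · simpa using hv1 _ _
      · obtain ⟨C', hC'⟩ := hVb (X i ω) (h0 i)
        have hite (q : Prop) [Decidable q] (z : ℝ) :
            (if q then 1 else ENNReal.ofReal z) = ENNReal.ofReal (if q then 1 else z) := by
          split_ifs <;> simp
        simp_rw [hite]
        refine ENNReal.tendsto_tprod_ofReal (hs.mul_left C') (fun j => ?_) (fun n j => ?_)
          (fun n j => ?_) (fun n j => ?_)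
        · split_ifs
          · exact tendsto_const_nhds
          · exact hVlim _ _ (h0 i) (h0 j)
        · split_ifs; exacts [zero_le_one, hV0 _ _ _]
        · split_ifs; exacts [le_rfl, hV1 _ _ _]
        · split_ifs
          · rw [sub_self]
            exact (sub_nonneg.2 (hV1 _ _ _)).trans (hC' n _)
          · exact hC' n _
  have hright : Tendsto (fun n => ∫⁻ x, ENNReal.ofReal (lam * F n (annulus n x) *
      Real.exp (-(lam * ∫ y, (1 - V n (annulus n x) (annulus n y)))))) atTop
      (𝓝 (∫⁻ x : Plane, ENNReal.ofReal (lam * f ‖x‖ *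
        Real.exp (-(lam * ∫ y : Plane, (1 - v ‖x‖ ‖y‖)))))) := by
    refine tendsto_lintegral_of_dominated_convergence
      (fun x => ENNReal.ofReal (lam * (C * D x))) (fun n => ?_)
      (fun n => Eventually.of_forall fun x => ENNReal.ofReal_le_ofReal ?_)
      ((hD.const_mul C).const_mul lam).lintegral_lt_top.ne ?_
    · exact (Measurable.of_discrete (f := fun k => ENNReal.ofReal (lam * F n k *
        Real.exp (-(lam * ∫ y, (1 - V n k (annulus n y))))))).comp (measurable_annulus n)
    · calc _ ≤ lam * F n (annulus n x) * 1 := by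
            refine mul_le_mul_of_nonneg_left (Real.exp_le_one_iff.2 ?_)
              (mul_nonneg hlam (hF0 _ _))
            exact neg_nonpos.2 (mul_nonneg hlam (integral_nonneg fun y => sub_nonneg.2 (hV1 _ _ _)))
        _ ≤ _ := by
            rw [mul_one]
            exact mul_le_mul_of_nonneg_left (hFb n x) hlam
    · have hne : ∀ᵐ x : Plane, x ≠ 0 := by simp [ae_iff]
      filter_upwards [hne] with x hx
      obtain ⟨C', hC'⟩ := hVb x hx
      refine (ENNReal.continuous_ofReal.tendsto _).comp
        (((hFlim x hx).const_mul lam).mul ((Real.continuous_exp.tendsto _).comp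
          (Tendsto.neg (Tendsto.const_mul lam ?_))))
      refine tendsto_integral_of_dominated_convergence (fun y => C' * D y) (fun n => ?_)
        (hD.const_mul C') (fun n => Eventually.of_forall fun y => ?_) ?_
      · exact ((Measurable.of_discrete (f := fun l => 1 - V n (annulus n x) l)).comp
          (measurable_annulus n)).aestronglyMeasurable
      · rw [Real.norm_eq_abs, abs_of_nonneg (sub_nonneg.2 (hV1 _ _ _))]
        exact hC' n y
      · filter_upwards [hne] with y hy
        exact (hVlim x y hx hy).const_sub 1
  exact tendsto_nhds_unique (hleft.congr hstep) hright

end IsHomogeneousPPP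

/-! ### Laplace transforms with values in the extended half-line -/

section ExpNeg

/-- The function `t ↦ exp (-t)` on `[0, ∞]`. -/
noncomputable def ENNReal.expNeg (t : ℝ≥0∞) : ℝ≥0∞ := (EReal.exp (t : EReal))⁻¹

namespace ENNReal

lemma continuous_expNeg : Continuous expNeg :=
  continuous_inv.comp (continuous_exp.comp continuous_coe_ennreal_ereal)

lemma expNeg_top : expNeg ∞ = 0 := by simp [expNeg]

lemma expNeg_zero : expNeg 0 = 1 := by simp [expNeg]

lemma expNeg_ofReal {x : ℝ} (hx : 0 ≤ x) :
    expNeg (ENNReal.ofReal x) = ENNReal.ofReal (Real.exp (-x)) := by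
  rw [expNeg, EReal.coe_ennreal_ofReal, max_eq_left hx, EReal.exp_coe, Real.exp_neg,
    ENNReal.ofReal_inv_of_pos (Real.exp_pos x)]

lemma expNeg_le_one (t : ℝ≥0∞) : expNeg t ≤ 1 := by
  rw [expNeg, ENNReal.inv_le_one, EReal.one_le_exp_iff]
  exact EReal.coe_ennreal_nonneg t

lemma expNeg_add (s t : ℝ≥0∞) : expNeg (s + t) = expNeg s * expNeg t := by
  have h (u : ℝ≥0∞) : EReal.exp (u : EReal) ≠ 0 := by simp
  rw [expNeg, EReal.coe_ennreal_add, EReal.exp_add,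
    ENNReal.mul_inv (Or.inl (h s)) (Or.inr (h t))]
  rfl

lemma expNeg_sum {ι : Type*} (u : Finset ι) (f : ι → ℝ≥0∞) :
    expNeg (∑ j ∈ u, f j) = ∏ j ∈ u, expNeg (f j) := by
  classical
  induction u using Finset.induction_on with
  | empty => simp [expNeg_zero]
  | insert j u hj ih => rw [Finset.sum_insert hj, Finset.prod_insert hj, expNeg_add, ih]

/-- The finite identity passes to the limit because `expNeg` is continuous on all of `[0, ∞]`; a
divergent interference sum therefore needs no separate treatment. -/
lemma expNeg_tsum (f : ℕ → ℝ≥0∞) : expNeg (∑' j, f j) = ∏' j, expNeg (f j) := by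
  have h : HasProd (fun j => expNeg (f j)) (expNeg (∑' j, f j)) :=
    ((continuous_expNeg.tendsto _).comp (ENNReal.summable (f := f)).hasSum).congr
      fun u => expNeg_sum u f
  exact h.tprod_eq.symm

end ENNReal

end ExpNeg

section ExpMeasure

lemma expMeasure_one_Ioi {x : ℝ} (hx : 0 ≤ x) :
    expMeasure 1 (Set.Ioi x) = ENNReal.ofReal (Real.exp (-x)) := by
  have := isProbabilityMeasure_expMeasure one_pos
  rw [← Set.compl_Iic, prob_compl_eq_one_sub measurableSet_Iic, ← ofReal_cdf,
    cdf_expMeasure_eq one_pos, if_pos hx, ← ENNReal.ofReal_one,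
    ← ENNReal.ofReal_sub _ (by simpa using hx)]
  simp

/-- Laplace transform of the exponential distribution. -/
lemma lintegral_expNeg_expMeasure {q : ℝ} (hq : 0 ≤ q) :
    ∫⁻ x, ENNReal.expNeg (ENNReal.ofReal (q * x)) ∂(expMeasure 1) =
      ENNReal.ofReal (1 / (1 + q)) := by
  have hm : expMeasure 1 = volume.withDensity (exponentialPDF 1) := rfl
  have hpm : Measurable (exponentialPDF 1) := (measurable_exponentialPDFReal 1).ennreal_ofReal
  have hem : Measurable fun x : ℝ => ENNReal.expNeg (ENNReal.ofReal (q * x)) :=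
    ENNReal.continuous_expNeg.measurable.comp (measurable_const.mul measurable_id).ennreal_ofReal
  rw [hm, lintegral_withDensity_eq_lintegral_mul _ hpm hem]
  have h (x : ℝ) : (exponentialPDF 1 * fun x => ENNReal.expNeg (ENNReal.ofReal (q * x))) x =
      (Set.Ici 0).indicator (fun x => ENNReal.ofReal (Real.exp (-(1 + q) * x))) x := by
    by_cases hx : 0 ≤ x
    · rw [Pi.mul_apply, exponentialPDF_of_nonneg hx, ENNReal.expNeg_ofReal (mul_nonneg hq hx),
        ← ENNReal.ofReal_mul (by positivity), Set.indicator_of_mem (Set.mem_Ici.2 hx), one_mul,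
        ← Real.exp_add]
      ring_nf
    · rw [Pi.mul_apply, exponentialPDF_of_neg (not_le.1 hx), zero_mul,
        Set.indicator_of_notMem (by simpa using hx)]
  have hq' : -(1 + q) < 0 := by linarith
  rw [lintegral_congr h, lintegral_indicator measurableSet_Ici, setLIntegral_congr Ioi_ae_eq_Ici.symm,
    ← ofReal_integral_eq_lintegral_ofReal (integrableOn_exp_mul_Ioi hq' 0)
      (Eventually.of_forall fun x => (Real.exp_pos _).le), integral_exp_mul_Ioi hq']
  congr 1
  simp only [mul_zero, Real.exp_zero]
  field_simp

end ExpMeasure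

/-- The expectation of an infinite product of independent random variables with values in the unit
interval. -/
lemma lintegral_tprod_of_iIndepFun {Ω : Type*} [MeasurableSpace Ω] {P : Measure Ω}
    [IsProbabilityMeasure P] {Y : ℕ → Ω → ℝ≥0∞} (hY : iIndepFun Y P) (hm : ∀ j, Measurable (Y j))
    (h1 : ∀ j ω, Y j ω ≤ 1) : ∫⁻ ω, ∏' j, Y j ω ∂P = ∏' j, ∫⁻ ω, Y j ω ∂P := by
  have hle (j : ℕ) : ∫⁻ ω, Y j ω ∂P ≤ 1 :=
    (lintegral_mono (h1 j)).trans (by simp)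
  have hL : Tendsto (fun n => ∫⁻ ω, ∏ j ∈ Finset.range n, Y j ω ∂P) atTop
      (𝓝 (∫⁻ ω, ∏' j, Y j ω ∂P)) := by
    refine tendsto_lintegral_of_dominated_convergence (fun _ => 1)
      (fun n => Finset.measurable_prod _ fun j _ => hm j)
      (fun n => Eventually.of_forall fun ω => Finset.prod_le_one' fun j _ => h1 j ω) (by simp)
      (Eventually.of_forall fun ω => ?_)
    exact (ENNReal.multipliable_of_le_one fun j => h1 j ω).tendsto_prod_tprod_nat
  refine tendsto_nhds_unique hL ?_
  simp_rw [fun n => lintegral_prod_eq_prod_lintegral_of_indepFun (Finset.range n) Y hY hm]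
  exact (ENNReal.multipliable_of_le_one hle).tendsto_prod_tprod_nat

/-! ### Measurability, conditioning on the locations, and the law of one mark -/

namespace HelloSlot

variable {Ω : Type*} [MeasurableSpace Ω] {M : ℕ} {s : HelloSlot Ω M} {α noise ξ : ℝ}

lemma measurable_sinr (hX : ∀ j, Measurable (s.X j)) (hZ : ∀ j, Measurable (s.Z j))
    (hB : ∀ j, Measurable (s.B j)) (hh : ∀ j, Measurable (s.h j)) (hg : ∀ j, Measurable (s.g j))
    (i : ℕ) : Measurable (s.sinr α noise i) := by
  have hp (j : ℕ) : Measurable fun ω => ‖s.X j ω‖ ^ (-α) := (hX j).norm.pow_const _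
  refine Measurable.div ((hp i).mul (hh i)).ennreal_ofReal (Measurable.add ?_ measurable_const)
  refine Measurable.tsum fun j => Measurable.ite ?_ ((hp j).mul (hg j)).ennreal_ofReal
    measurable_const
  exact (MeasurableSet.const _).inter
    ((hZ j (.singleton true)).inter (measurableSet_eq_fun (hB j) (hB i)))

lemma measurableSet_mem_discovered (hX : ∀ j, Measurable (s.X j)) (hZ₀ : Measurable s.Z₀)
    (hZ : ∀ j, Measurable (s.Z j)) (hB : ∀ j, Measurable (s.B j)) (hh : ∀ j, Measurable (s.h j))
    (hg : ∀ j, Measurable (s.g j)) (i : ℕ) :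
    MeasurableSet {ω | i ∈ s.discovered α noise ξ ω} :=
  (hZ₀ (.singleton false)).inter ((hZ i (.singleton true)).inter
    (measurableSet_lt measurable_const (measurable_sinr hX hZ hB hh hg i)))

lemma measurable_numDiscovered (hX : ∀ j, Measurable (s.X j)) (hZ₀ : Measurable s.Z₀)
    (hZ : ∀ j, Measurable (s.Z j)) (hB : ∀ j, Measurable (s.B j)) (hh : ∀ j, Measurable (s.h j))
    (hg : ∀ j, Measurable (s.g j)) : Measurable (s.numDiscovered α noise ξ) :=
  (Measurable.of_discrete (f := ENat.toENNReal)).comp (measurable_encard.comp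
    (measurable_set_iff.2 fun i => measurableSet_setOfPred.1
      (measurableSet_mem_discovered hX hZ₀ hZ hB hh hg i)))

lemma lintegral_numDiscovered_eq_tsum (P : Measure Ω) (hX : ∀ j, Measurable (s.X j))
    (hZ₀ : Measurable s.Z₀)
    (hZ : ∀ j, Measurable (s.Z j)) (hB : ∀ j, Measurable (s.B j)) (hh : ∀ j, Measurable (s.h j))
    (hg : ∀ j, Measurable (s.g j)) :
    ∫⁻ ω, s.numDiscovered α noise ξ ω ∂P = ∑' i, P {ω | i ∈ s.discovered α noise ξ ω} := by
  classical
  have hm := measurableSet_mem_discovered (α := α) (noise := noise) (ξ := ξ) hX hZ₀ hZ hB hh hg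
  have h (ω : Ω) : s.numDiscovered α noise ξ ω =
      ∑' i, {ω | i ∈ s.discovered α noise ξ ω}.indicator (fun _ => 1) ω := by
    have := ENNReal.tsum_ite_const (p := fun i => i ∈ s.discovered α noise ξ ω) 1
    rw [mul_one] at this
    exact this.symm
  rw [lintegral_congr h, lintegral_tsum fun i => (measurable_const.indicator (hm i)).aemeasurable]
  simp [lintegral_indicator_const (hm _)]

/-- The slot in which the nodes have the deterministic locations `x j`. -/
def atLocations (s : HelloSlot Ω M) (x : ℕ → Plane) : HelloSlot Ω M :=
  { s with X := fun j _ => x j }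

/-- The slot of coordinate functions. -/
def coordinates (M : ℕ) : HelloSlot ((ℕ → Plane) × Bool × (ℕ → Bool × Fin M × ℝ × ℝ)) M where
  X j a := a.1 j
  Z₀ a := a.2.1
  Z j a := (a.2.2 j).1
  B j a := (a.2.2 j).2.1
  h j a := (a.2.2 j).2.2.1
  g j a := (a.2.2 j).2.2.2

/-- Joint measurability in locations and marks, as Tonelli requires in `lintegral_numDiscovered`. -/
lemma measurable_numDiscovered_coordinates :
    Measurable ((coordinates M).numDiscovered α noise ξ) :=
  measurable_numDiscovered (fun j => by unfold coordinates; fun_prop)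
    (by unfold coordinates; fun_prop) (fun j => by unfold coordinates; fun_prop)
    (fun j => by unfold coordinates; fun_prop) (fun j => by unfold coordinates; fun_prop)
    (fun j => by unfold coordinates; fun_prop)

namespace IsRayleighModel

variable {P : Measure Ω} [IsProbabilityMeasure P] {lam ρ : ℝ}

omit [IsProbabilityMeasure P] in
lemma measurable_mark (hs : s.IsRayleighModel P lam ρ) (j : ℕ) : Measurable (s.mark j) :=
  (hs.measurable_Z j).prodMk ((hs.measurable_B j).prodMk
    ((hs.measurable_h j).prodMk (hs.measurable_g j)))

/-- Locations are independent of everything else, so the joint law is a product and the marks can be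
integrated out first, with the locations frozen. -/
lemma lintegral_numDiscovered (hs : s.IsRayleighModel P lam ρ) :
    ∫⁻ ω, s.numDiscovered α noise ξ ω ∂P =
      ∫⁻ ω, ∫⁻ ω', (s.atLocations fun j => s.X j ω).numDiscovered α noise ξ ω' ∂P ∂P := by
  have hX : Measurable fun ω j => s.X j ω := measurable_pi_lambda _ hs.ppp.measurable
  have hm : Measurable fun ω => (s.Z₀ ω, fun j => s.mark j ω) :=
    hs.measurable_Z₀.prodMk (measurable_pi_lambda _ hs.measurable_mark)
  have hN : Measurable ((coordinates M).numDiscovered α noise ξ) :=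
    measurable_numDiscovered_coordinates
  calc _ = ∫⁻ a, (coordinates M).numDiscovered α noise ξ a
        ∂(P.map fun ω => ((fun j => s.X j ω), (s.Z₀ ω, fun j => s.mark j ω))) :=
        (lintegral_map hN (hX.prodMk hm)).symm
    _ = ∫⁻ x, ∫⁻ a, (coordinates M).numDiscovered α noise ξ (x, a)
        ∂(P.map fun ω => (s.Z₀ ω, fun j => s.mark j ω)) ∂(P.map fun ω j => s.X j ω) := by
        rw [(indepFun_iff_map_prod_eq_prod_map_map hX.aemeasurable hm.aemeasurable).1
          hs.indep_locations, lintegral_prod _ hN.aemeasurable]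
    _ = ∫⁻ ω, ∫⁻ a, (coordinates M).numDiscovered α noise ξ ((fun j => s.X j ω), a)
        ∂(P.map fun ω => (s.Z₀ ω, fun j => s.mark j ω)) ∂P :=
        lintegral_map hN.lintegral_prod_right' hX
    _ = _ := lintegral_congr fun ω => lintegral_map (hN.comp measurable_prodMk_left) hm

section Marks

variable (hs : s.IsRayleighModel P lam ρ)
include hs

omit [IsProbabilityMeasure P] in
lemma measurableSet_transmits_on (j : ℕ) (b : Fin M) :
    MeasurableSet {ω | s.Z j ω = true ∧ s.B j ω = b} :=
  (hs.measurable_Z j (.singleton true)).inter (hs.measurable_B j (.singleton b))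

omit [IsProbabilityMeasure P] in
-- Mode, block and the pair of gains are successively independent. The pair is kept together in `A`;
-- later `A` constrains at most one coordinate, so only the marginal laws of the gains enter.
lemma measure_transmits_on_inter (j : ℕ) (b : Fin M) {A : Set (ℝ × ℝ)} (hA : MeasurableSet A) :
    P ({ω | (s.h j ω, s.g j ω) ∈ A} ∩ {ω | s.Z j ω = true ∧ s.B j ω = b}) =
      ENNReal.ofReal ρ * (M : ℝ≥0∞)⁻¹ * P {ω | (s.h j ω, s.g j ω) ∈ A} := by
  have h1 := (hs.indep_mode j).measure_inter_preimage_eq_mul {true} ({b} ×ˢ A) (.singleton _)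
    ((MeasurableSet.singleton b).prod hA)
  have h2 := (hs.indep_block j).measure_inter_preimage_eq_mul {b} A (.singleton _) hA
  have e1 : s.Z j ⁻¹' {true} ∩ (fun ω => (s.B j ω, s.h j ω, s.g j ω)) ⁻¹' ({b} ×ˢ A) =
      {ω | (s.h j ω, s.g j ω) ∈ A} ∩ {ω | s.Z j ω = true ∧ s.B j ω = b} := by
    ext ω; simp; tauto
  have e2 : (fun ω => (s.B j ω, s.h j ω, s.g j ω)) ⁻¹' ({b} ×ˢ A) =
      s.B j ⁻¹' {b} ∩ (fun ω => (s.h j ω, s.g j ω)) ⁻¹' A := by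
    ext ω; simp
  rw [e1, e2, h2] at h1
  rw [h1, mul_assoc]
  exact congrArg₂ _ (hs.law_Z j) (congrArg₂ _ (hs.law_B j b) rfl)

lemma measure_transmits_on (j : ℕ) (b : Fin M) :
    P {ω | s.Z j ω = true ∧ s.B j ω = b} = ENNReal.ofReal ρ * (M : ℝ≥0∞)⁻¹ := by
  simpa using hs.measure_transmits_on_inter j b MeasurableSet.univ

omit [IsProbabilityMeasure P] in
lemma setLIntegral_transmits_on (j : ℕ) (b : Fin M) {u : ℝ → ℝ≥0∞} (hu : Measurable u) :
    ∫⁻ ω in {ω | s.Z j ω = true ∧ s.B j ω = b}, u (s.g j ω) ∂P =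
      ENNReal.ofReal ρ * (M : ℝ≥0∞)⁻¹ * ∫⁻ y, u y ∂(expMeasure 1) := by
  have h : (P.restrict {ω | s.Z j ω = true ∧ s.B j ω = b}).map (s.g j) =
      (ENNReal.ofReal ρ * (M : ℝ≥0∞)⁻¹) • expMeasure 1 := by
    ext A hA
    rw [← hs.law_g j, Measure.smul_apply, Measure.map_apply (hs.measurable_g j) hA,
      Measure.map_apply (hs.measurable_g j) hA, Measure.restrict_apply (hs.measurable_g j hA)]
    exact hs.measure_transmits_on_inter j b (measurable_snd hA)
  rw [← lintegral_map hu (hs.measurable_g j), h, lintegral_smul_measure, smul_eq_mul]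

/-- Laplace transform of the interference contributed by one node. -/
lemma lintegral_expNeg_transmits_on (hM : 1 ≤ M) (hρ₀ : 0 ≤ ρ) (hρ₁ : ρ ≤ 1) (j : ℕ) (b : Fin M)
    {q : ℝ} (hq : 0 ≤ q) :
    ∫⁻ ω, ENNReal.expNeg (if s.Z j ω = true ∧ s.B j ω = b
        then ENNReal.ofReal (q * s.g j ω) else 0) ∂P =
      ENNReal.ofReal (1 - ρ / M * (q / (1 + q))) := by
  have hM' : (1 : ℝ) ≤ M := by exact_mod_cast hM
  have hp : ENNReal.ofReal ρ * (M : ℝ≥0∞)⁻¹ = ENNReal.ofReal (ρ / M) := by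
    rw [div_eq_mul_inv, ENNReal.ofReal_mul hρ₀, ENNReal.ofReal_inv_of_pos (by linarith),
      ENNReal.ofReal_natCast]
  have hp1 : ρ / M ≤ 1 := div_le_one_of_le₀ (hρ₁.trans hM') (by linarith)
  have hE := hs.measurableSet_transmits_on j b
  have hu : Measurable fun y : ℝ => ENNReal.expNeg (ENNReal.ofReal (q * y)) :=
    ENNReal.continuous_expNeg.measurable.comp (measurable_const.mul measurable_id).ennreal_ofReal
  rw [← lintegral_add_compl _ hE]
  have h1 : ∫⁻ ω in {ω | s.Z j ω = true ∧ s.B j ω = b}, ENNReal.expNeg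
      (if s.Z j ω = true ∧ s.B j ω = b then ENNReal.ofReal (q * s.g j ω) else 0) ∂P =
      ENNReal.ofReal (ρ / M) * ENNReal.ofReal (1 / (1 + q)) := by
    rw [← hp, ← lintegral_expNeg_expMeasure hq, ← hs.setLIntegral_transmits_on j b hu]
    refine setLIntegral_congr_fun hE fun ω hω => ?_
    simp only [Set.mem_ofPred_eq] at hω
    simp only [if_pos hω]
  have h2 : ∫⁻ ω in {ω | s.Z j ω = true ∧ s.B j ω = b}ᶜ, ENNReal.expNeg
      (if s.Z j ω = true ∧ s.B j ω = b then ENNReal.ofReal (q * s.g j ω) else 0) ∂P =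
      ENNReal.ofReal (1 - ρ / M) := by
    rw [ENNReal.ofReal_sub _ (by positivity), ENNReal.ofReal_one, ← hp,
      ← hs.measure_transmits_on j b, ← prob_compl_eq_one_sub hE, ← setLIntegral_one]
    refine setLIntegral_congr_fun hE.compl fun ω hω => ?_
    simp only [Set.mem_compl_iff, Set.mem_ofPred_eq] at hω
    simp only [if_neg hω, ENNReal.expNeg_zero]
  rw [h1, h2, ← ENNReal.ofReal_mul (by positivity),
    ← ENNReal.ofReal_add (by positivity) (sub_nonneg.2 hp1)]
  congr 1
  field_simp
  ring

end Marks

end IsRayleighModel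

end HelloSlot

/-- A SINR `a y / (t + n)` exceeds the threshold `ξ` iff the gain `y` exceeds `(ξ / a) (t + n)`. -/
lemma expMeasure_one_sinr {a n ξ : ℝ} (ha : 0 < a) (hn : 0 < n) (hξ : 0 < ξ) (t : ℝ≥0∞) :
    expMeasure 1 {y | ENNReal.ofReal ξ < ENNReal.ofReal (a * y) / (t + ENNReal.ofReal n)} =
      ENNReal.expNeg (ENNReal.ofReal (ξ / a) * (t + ENNReal.ofReal n)) := by
  induction t with
  -- Infinite interference: the quotient is 0, so the event is empty, in agreement with `expNeg ∞ =
  -- 0`.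
  | top =>
    rw [top_add, ENNReal.mul_top (by simp; positivity), ENNReal.expNeg_top]
    simp
  | coe t =>
    have ht : (t : ℝ≥0∞) + ENNReal.ofReal n = ENNReal.ofReal (t + n) := by
      rw [ENNReal.ofReal_add t.coe_nonneg hn.le, ENNReal.ofReal_coe_nnreal]
    have htn : 0 < (t : ℝ) + n := by positivity
    rw [ht, ← ENNReal.ofReal_mul (by positivity), ENNReal.expNeg_ofReal (by positivity),
      ← expMeasure_one_Ioi (by positivity)]
    congr 1
    ext y
    simp only [Set.mem_ofPred_eq, Set.mem_Ioi]
    rw [ENNReal.lt_div_iff_mul_lt (Or.inr ENNReal.ofReal_ne_top) (Or.inl ENNReal.ofReal_ne_top),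
      ← ENNReal.ofReal_mul hξ.le, ENNReal.ofReal_lt_ofReal_iff_of_nonneg (by positivity),
      div_mul_eq_mul_div, div_lt_iff₀ ha, mul_comm y a]

/-! ### Discovery probabilities for fixed locations -/

namespace HelloSlot

variable {Ω : Type*} [MeasurableSpace Ω] {M : ℕ} {s : HelloSlot Ω M}

/-- The interference that node `j` causes at the typical node to the packet of node `i` on resource
block `b`, as a function of the mark of node `j`, when the received powers are scaled by `a`. -/
noncomputable def markInterference (a : ℕ → ℝ) (i : ℕ) (b : Fin M) (j : ℕ)
    (m : Bool × Fin M × ℝ × ℝ) : ℝ≥0∞ :=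
  if j ≠ i ∧ m.1 = true ∧ m.2.1 = b then ENNReal.ofReal (a j * m.2.2.2) else 0

lemma measurable_markInterference (a : ℕ → ℝ) (i : ℕ) (b : Fin M) (j : ℕ) :
    Measurable (markInterference a i b j) := by
  refine Measurable.ite ?_ (by fun_prop) measurable_const
  exact (MeasurableSet.const _).inter ((measurable_fst (.singleton true)).inter
    (measurable_snd.fst (.singleton b)))

namespace IsRayleighModel

variable {P : Measure Ω} [IsProbabilityMeasure P] {lam ρ : ℝ}

section

variable (hs : s.IsRayleighModel P lam ρ)
include hs

omit [IsProbabilityMeasure P] in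
-- The interference on the fixed block `b` is measurable for the sigma-algebra generated by the
-- marks of the nodes other than `i`, since its `i`-th term vanishes. Fixing `b` matters: the block
-- of node `i` is itself part of the mark of `i`.
lemma indepFun_mark_interference (a : ℕ → ℝ) (i : ℕ) (b : Fin M) :
    IndepFun (s.mark i) (fun ω => ∑' j, markInterference a i b j (s.mark j ω)) P := by
  rw [IndepFun_iff_Indep]
  have h := indep_iSup_of_disjoint (fun j => (hs.measurable_mark j).comap_le) hs.indep_marks
    (S := {i}) (T := {i}ᶜ) disjoint_compl_right
  refine indep_of_indep_of_le_left (indep_of_indep_of_le_right h ?_) (by simp)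
  refine Measurable.comap_le ?_
  refine @Measurable.tsum Ω ℝ≥0∞ ℕ
    (⨆ j ∈ ({i}ᶜ : Set ℕ), MeasurableSpace.comap (s.mark j) inferInstance)
    _ _ _ _ _ _ _ _ _ _ _ _ fun j => ?_
  by_cases hj : j = i
  · have : (fun ω => markInterference a i b j (s.mark j ω)) = fun _ => 0 := by
      ext ω; simp [markInterference, hj]
    rw [this]
    exact measurable_const
  · refine Measurable.mono ((measurable_markInterference a i b j).comp
      (comap_measurable (s.mark j))) ?_ le_rfl
    exact le_iSup₂_of_le j hj le_rfl

/-- `expNeg` turns the sum over nodes into a product of independent factors in `[0, 1]`, each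
computed by `lintegral_expNeg_transmits_on`. -/
lemma lintegral_expNeg_interference (hM : 1 ≤ M) (hρ₀ : 0 ≤ ρ) (hρ₁ : ρ ≤ 1) {a : ℕ → ℝ}
    (ha : ∀ j, 0 ≤ a j) {q : ℝ} (hq : 0 ≤ q) (i : ℕ) (b : Fin M) :
    ∫⁻ ω, ENNReal.expNeg (ENNReal.ofReal q * ∑' j, markInterference a i b j (s.mark j ω)) ∂P =
      ∏' j, if j = i then 1 else
        ENNReal.ofReal (1 - ρ / M * (q * a j / (1 + q * a j))) := by
  have hm (j : ℕ) : Measurable fun m => ENNReal.expNeg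
      (ENNReal.ofReal q * markInterference a i b j m) :=
    ENNReal.continuous_expNeg.measurable.comp
      ((measurable_markInterference a i b j).const_mul _)
  simp_rw [← ENNReal.tsum_mul_left, ENNReal.expNeg_tsum]
  rw [lintegral_tprod_of_iIndepFun
    (Y := fun j ω => ENNReal.expNeg (ENNReal.ofReal q * markInterference a i b j (s.mark j ω)))
    (hs.indep_marks.comp (fun j m => ENNReal.expNeg
      (ENNReal.ofReal q * markInterference a i b j m)) hm)
    (fun j => (hm j).comp (hs.measurable_mark j)) (fun j ω => ENNReal.expNeg_le_one _)]
  refine tprod_congr fun j => ?_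
  split_ifs with hj
  · simp [markInterference, hj, ENNReal.expNeg_zero]
  · rw [← hs.lintegral_expNeg_transmits_on hM hρ₀ hρ₁ j b (mul_nonneg hq (ha j))]
    refine lintegral_congr fun ω => ?_
    simp only [markInterference, mark, ne_eq, hj, not_false_eq_true, true_and,
      mul_ite, mul_zero, ← ENNReal.ofReal_mul hq, mul_assoc]

/-- The probability that node `i` transmits on resource block `b` and that its packet is decoded,
for deterministic received powers. -/
lemma measure_decoded (hM : 1 ≤ M) (hρ₀ : 0 ≤ ρ) (hρ₁ : ρ ≤ 1) {a : ℕ → ℝ}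
    (ha : ∀ j, 0 < a j) {n ξ : ℝ} (hn : 0 < n) (hξ : 0 < ξ) (i : ℕ) (b : Fin M) :
    P {ω | (s.Z i ω = true ∧ s.B i ω = b) ∧ ENNReal.ofReal ξ <
        ENNReal.ofReal (a i * s.h i ω) /
          ((∑' j, markInterference a i b j (s.mark j ω)) + ENNReal.ofReal n)} =
      ENNReal.ofReal ρ * (M : ℝ≥0∞)⁻¹ * (ENNReal.ofReal (Real.exp (-(ξ / a i * n))) *
        ∏' j, if j = i then 1 else
          ENNReal.ofReal (1 - ρ / M * (ξ / a i * a j / (1 + ξ / a i * a j)))) := by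
  have hq : 0 ≤ ξ / a i := (div_pos hξ (ha i)).le
  set I : Ω → ℝ≥0∞ := fun ω => ∑' j, markInterference a i b j (s.mark j ω) with hI
  have hIm : Measurable I := Measurable.tsum fun j =>
    (measurable_markInterference a i b j).comp (hs.measurable_mark j)
  let D : Set ((Bool × Fin M × ℝ × ℝ) × ℝ≥0∞) := {z | (z.1.1 = true ∧ z.1.2.1 = b) ∧
    ENNReal.ofReal ξ < ENNReal.ofReal (a i * z.1.2.2.1) / (z.2 + ENNReal.ofReal n)}
  have hD : MeasurableSet D := by
    refine MeasurableSet.inter (MeasurableSet.inter ?_ ?_) ?_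
    · exact measurable_fst.fst (.singleton true)
    · exact measurable_fst.snd.fst (.singleton b)
    · have h1 : Measurable fun z : (Bool × Fin M × ℝ × ℝ) × ℝ≥0∞ =>
          ENNReal.ofReal (a i * z.1.2.2.1) := by fun_prop
      have h2 : Measurable fun z : (Bool × Fin M × ℝ × ℝ) × ℝ≥0∞ =>
          z.2 + ENNReal.ofReal n := by fun_prop
      exact measurableSet_lt measurable_const (h1.div h2)
  -- With the interference frozen at `t`, only the mark of `i` is random and the exponential tail of
  -- `h i` gives the probability.
  have hsec (t : ℝ≥0∞) : P.map (s.mark i) ((fun m => (m, t)) ⁻¹' D) =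
      ENNReal.ofReal ρ * (M : ℝ≥0∞)⁻¹ *
        ENNReal.expNeg (ENNReal.ofReal (ξ / a i) * (t + ENNReal.ofReal n)) := by
    have hA : MeasurableSet {y : ℝ | ENNReal.ofReal ξ <
        ENNReal.ofReal (a i * y) / (t + ENNReal.ofReal n)} :=
      measurableSet_lt measurable_const (Measurable.div (by fun_prop) measurable_const)
    rw [Measure.map_apply (hs.measurable_mark i) (measurable_prodMk_right hD),
      ← expMeasure_one_sinr (ha i) hn hξ t, ← hs.law_h i, Measure.map_apply (hs.measurable_h i) hA]
    have := hs.measure_transmits_on_inter i b (measurable_fst hA)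
    rw [Set.inter_comm] at this
    exact this
  calc _ = P.map (fun ω => (s.mark i ω, I ω)) D :=
        (Measure.map_apply ((hs.measurable_mark i).prodMk hIm) hD).symm
    _ = ∫⁻ t, P.map (s.mark i) ((fun m => (m, t)) ⁻¹' D) ∂(P.map I) := by
        have := Measure.isProbabilityMeasure_map (μ := P) (hs.measurable_mark i).aemeasurable
        rw [(indepFun_iff_map_prod_eq_prod_map_map (hs.measurable_mark i).aemeasurable
          hIm.aemeasurable).1 (hs.indepFun_mark_interference a i b), Measure.prod_apply_symm hD]
    _ = ∫⁻ ω, ENNReal.ofReal ρ * (M : ℝ≥0∞)⁻¹ *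
        ENNReal.expNeg (ENNReal.ofReal (ξ / a i) * (I ω + ENNReal.ofReal n)) ∂P := by
        simp_rw [hsec]
        rw [lintegral_map _ hIm]
        exact (ENNReal.continuous_expNeg.measurable.comp
          ((measurable_id.add_const _).const_mul _)).const_mul _
    _ = _ := by
        have hem : Measurable fun ω => ENNReal.expNeg (ENNReal.ofReal (ξ / a i) * I ω) :=
          ENNReal.continuous_expNeg.measurable.comp (hIm.const_mul _)
        simp_rw [mul_add, ENNReal.expNeg_add]
        rw [lintegral_const_mul _ (hem.mul_const _), lintegral_mul_const _ hem,
          hs.lintegral_expNeg_interference hM hρ₀ hρ₁ (fun j => (ha j).le) hq,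
          ← ENNReal.ofReal_mul hq, ENNReal.expNeg_ofReal (by positivity), mul_comm
            (ENNReal.ofReal (Real.exp _))]

/-- The probability that the typical node discovers node `i`, for deterministic locations. -/
lemma measure_mem_discovered_atLocations (hM : 1 ≤ M) (hρ₀ : 0 ≤ ρ) (hρ₁ : ρ ≤ 1)
    {x : ℕ → Plane} (hx : ∀ j, x j ≠ 0) {ξ σ : ℝ} (hξ : 0 < ξ) (hσ : 0 < σ) (i : ℕ) :
    P {ω | i ∈ (s.atLocations x).discovered 4 (σ ^ 2) ξ ω} =
      ENNReal.ofReal (ρ * (1 - ρ)) * (ENNReal.ofReal (Real.exp (-(ξ * σ ^ 2 * ‖x i‖ ^ 4))) *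
        ∏' j, if j = i then 1 else ENNReal.ofReal
          (1 - ρ / M * (ξ * ‖x i‖ ^ 4 / (‖x j‖ ^ 4 + ξ * ‖x i‖ ^ 4)))) := by
  let a (j : ℕ) : ℝ := ‖x j‖ ^ (-4 : ℝ)
  have hx' (j : ℕ) : 0 < ‖x j‖ := norm_pos_iff.2 (hx j)
  have haeq (j : ℕ) : a j = (‖x j‖ ^ 4)⁻¹ := by
    simp only [a]
    rw [Real.rpow_neg (hx' j).le]
    norm_cast
  have ha (j : ℕ) : 0 < a j := Real.rpow_pos_of_pos (hx' j) _
  let E (b : Fin M) : Set Ω := {ω | (s.Z i ω = true ∧ s.B i ω = b) ∧ ENNReal.ofReal ξ <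
    ENNReal.ofReal (a i * s.h i ω) /
      ((∑' j, markInterference a i b j (s.mark j ω)) + ENNReal.ofReal (σ ^ 2))}
  -- Splitting by the block of node `i` writes decoding as an event in the marks alone. It is
  -- therefore independent of the typical node's mode, and its pieces are disjoint.
  let T : Set (ℕ → Bool × Fin M × ℝ × ℝ) := ⋃ b : Fin M,
    {m | ((m i).1 = true ∧ (m i).2.1 = b) ∧ ENNReal.ofReal ξ <
      ENNReal.ofReal (a i * (m i).2.2.1) /
        ((∑' j, markInterference a i b j (m j)) + ENNReal.ofReal (σ ^ 2))}
  have hT : MeasurableSet T := by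
    refine MeasurableSet.iUnion fun b => MeasurableSet.inter (MeasurableSet.inter ?_ ?_) ?_
    · exact (measurable_pi_apply i).fst (.singleton true)
    · exact (measurable_pi_apply i).snd.fst (.singleton b)
    · have h1 : Measurable fun m : ℕ → Bool × Fin M × ℝ × ℝ =>
          ENNReal.ofReal (a i * (m i).2.2.1) := by fun_prop
      refine measurableSet_lt measurable_const (h1.div
        (Measurable.add_const (Measurable.tsum fun j => ?_) _))
      exact (measurable_markInterference a i b j).comp (measurable_pi_apply j)
  have hTE : (fun ω j => s.mark j ω) ⁻¹' T = ⋃ b, E b := by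
    simp only [T, Set.preimage_iUnion]
    rfl
  have hset : {ω | i ∈ (s.atLocations x).discovered 4 (σ ^ 2) ξ ω} =
      s.Z₀ ⁻¹' {false} ∩ (fun ω j => s.mark j ω) ⁻¹' T := by
    rw [hTE]
    ext ω
    simp only [discovered, sinr, interference, atLocations, Set.mem_ofPred_eq, Set.mem_inter_iff,
      Set.mem_preimage, Set.mem_singleton_iff, Set.mem_iUnion, E]
    constructor
    · rintro ⟨h0, h1, h2⟩
      exact ⟨h0, s.B i ω, ⟨h1, rfl⟩, h2⟩
    · rintro ⟨h0, b, ⟨h1, rfl⟩, h2⟩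
      exact ⟨h0, h1, h2⟩
  have hEm (b : Fin M) : MeasurableSet (E b) := by
    have hb : MeasurableSet {m : ℕ → Bool × Fin M × ℝ × ℝ | (m i).2.1 = b} :=
      (measurable_pi_apply i).snd.fst (.singleton b)
    have : E b = (fun ω j => s.mark j ω) ⁻¹' T ∩ {ω | s.B i ω = b} := by
      rw [hTE]
      ext ω
      simp only [E, Set.mem_inter_iff, Set.mem_iUnion, Set.mem_ofPred_eq]
      constructor
      · exact fun h => ⟨⟨b, h⟩, h.1.2⟩
      · rintro ⟨⟨b', h⟩, h'⟩
        obtain rfl : b' = b := h.1.2.symm.trans h'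
        exact h
    rw [this]
    exact (measurable_pi_lambda _ hs.measurable_mark hT).inter (hs.measurable_B i (.singleton b))
  have hdisj : Pairwise (Function.onFun Disjoint E) := fun b b' hbb' =>
    Set.disjoint_left.2 fun ω h h' => hbb' (h.1.2.symm.trans h'.1.2)
  have hZ : P (s.Z₀ ⁻¹' {false}) = ENNReal.ofReal (1 - ρ) := by
    have hc : s.Z₀ ⁻¹' {false} = {ω | s.Z₀ ω = true}ᶜ := by ext; simp
    have hm : MeasurableSet {ω | s.Z₀ ω = true} := hs.measurable_Z₀ (.singleton true)
    rw [hc, prob_compl_eq_one_sub hm, hs.law_Z₀,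
      ENNReal.ofReal_sub _ hρ₀, ENNReal.ofReal_one]
  have hfac (j : ℕ) : ξ / a i * a j / (1 + ξ / a i * a j) =
      ξ * ‖x i‖ ^ 4 / (‖x j‖ ^ 4 + ξ * ‖x i‖ ^ 4) := by
    have := hx' i
    have := hx' j
    rw [haeq, haeq]
    field_simp
  have hexp : ξ / a i * σ ^ 2 = ξ * σ ^ 2 * ‖x i‖ ^ 4 := by
    rw [haeq, div_inv_eq_mul]
    ring
  have hMne : (M : ℝ≥0∞) ≠ 0 := by
    simp only [ne_eq, Nat.cast_eq_zero]
    lia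
  rw [hset, hs.indep_typical.measure_inter_preimage_eq_mul _ _ (.singleton _) hT, hZ, hTE,
    measure_iUnion hdisj hEm, tsum_fintype]
  simp only [E, hs.measure_decoded hM hρ₀ hρ₁ ha (sq_pos_of_pos hσ) hξ i, hexp, hfac,
    Finset.sum_const, Finset.card_univ, Fintype.card_fin, nsmul_eq_mul]
  -- The `M` blocks contribute equally, and their number cancels the probability `1 / M` of each.
  rw [mul_comm ρ, ENNReal.ofReal_mul (sub_nonneg.2 hρ₁), mul_comm (ENNReal.ofReal ρ),
    mul_assoc (M : ℝ≥0∞)⁻¹, ← mul_assoc (M : ℝ≥0∞),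
    ENNReal.mul_inv_cancel hMne (ENNReal.natCast_ne_top M), one_mul, mul_assoc (ENNReal.ofReal (1 - ρ))]

/-- The mean number of discoveries, as an expectation over the locations only. -/
theorem lintegral_numDiscovered_eq (hlam : 0 ≤ lam) (hM : 1 ≤ M) (hρ₀ : 0 ≤ ρ) (hρ₁ : ρ ≤ 1)
    {ξ σ : ℝ} (hξ : 0 < ξ) (hσ : 0 < σ) :
    ∫⁻ ω, s.numDiscovered 4 (σ ^ 2) ξ ω ∂P =
      ENNReal.ofReal (ρ * (1 - ρ)) * ∫⁻ ω, ∑' i,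
        ENNReal.ofReal (Real.exp (-(ξ * σ ^ 2 * ‖s.X i ω‖ ^ 4))) *
          ∏' j, (if j = i then 1 else ENNReal.ofReal
            (1 - ρ / M * (ξ * ‖s.X i ω‖ ^ 4 / (‖s.X j ω‖ ^ 4 + ξ * ‖s.X i ω‖ ^ 4)))) ∂P := by
  rw [hs.lintegral_numDiscovered, ← lintegral_const_mul' _ _ ENNReal.ofReal_ne_top]
  refine lintegral_congr_ae ?_
  filter_upwards [hs.ppp.ae_ne_zero hlam] with ω hω
  rw [lintegral_numDiscovered_eq_tsum (s := s.atLocations fun j => s.X j ω) P (fun j => measurable_const) hs.measurable_Z₀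
    hs.measurable_Z hs.measurable_B hs.measurable_h hs.measurable_g, ← ENNReal.tsum_mul_left]
  exact tsum_congr fun i => hs.measure_mem_discovered_atLocations hM hρ₀ hρ₁ hω hξ hσ i

end

end IsRayleighModel

end HelloSlot

/-! ### Domination estimates and conclusion -/

/-- Provides a bound uniform over inner radii `t ≥ ‖y‖ - 1`, independent of the annulus width. The
majorant is integrable on the plane because its exponent 4 exceeds the dimension 2. -/
lemma one_div_one_add_pow_four_le {k : ℝ} (hk : 0 < k) {y : Plane} {t : ℝ}
    (hyt : ‖y‖ - 1 ≤ t) :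
    1 / (1 + k * t ^ 4) ≤ (128 + 8 / k) * (1 + ‖y‖) ^ (-4 : ℝ) := by
  have hy : 0 < 1 + ‖y‖ := by positivity
  -- Convexity of the fourth power gives `(2 + t)⁴ ≤ 8 (2⁴ + t⁴)`, whence 128 and 8.
  have h1 : (1 + ‖y‖) ^ 4 ≤ 128 + 8 * t ^ 4 := by
    calc (1 + ‖y‖) ^ 4 ≤ (2 + t) ^ 4 := pow_le_pow_left₀ hy.le (by linarith) 4
      _ ≤ 128 + 8 * t ^ 4 := by
        nlinarith [sq_nonneg (t - 2), sq_nonneg (t ^ 2 - 4), sq_nonneg (t * (t - 2))]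
  have h2 : (128 + 8 / k) * (1 + k * t ^ 4) = 128 + 8 * t ^ 4 + (128 * k * t ^ 4 + 8 / k) := by
    field_simp
    ring
  have h3 : (0 : ℝ) ≤ 128 * k * t ^ 4 + 8 / k := by positivity
  rw [Real.rpow_neg hy.le, show (4 : ℝ) = (4 : ℕ) by norm_num, Real.rpow_natCast,
    ← div_eq_mul_inv, div_le_div_iff₀ (by positivity) (by positivity)]
  linarith

theorem proposition3 {Ω : Type*} [MeasurableSpace Ω] (P : Measure Ω) [IsProbabilityMeasure P]
    (M : ℕ) (hM : 1 ≤ M) (lam ρ ξ σ : ℝ) (hlam : 0 < lam) (hρ₀ : 0 ≤ ρ) (hρ₁ : ρ ≤ 1)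
    (hξ : 0 < ξ) (hσ : 0 < σ) (s : HelloSlot Ω M) (hs : s.IsRayleighModel P lam ρ) :
    Measurable (s.numDiscovered 4 (σ ^ 2) ξ) ∧
    ∫⁻ ω, s.numDiscovered 4 (σ ^ 2) ξ ω ∂P =
      ENNReal.ofReal
        (lam * Real.pi ^ (3 / 2 : ℝ) * ρ * (1 - ρ) / (2 * Real.sqrt (ξ * σ ^ 2)) *
          Real.exp ((lam * Real.pi ^ 2 * ρ / (4 * M * σ)) ^ 2) *
          erfc (lam * Real.pi ^ 2 * ρ / (4 * M * σ))) := by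
  refine ⟨HelloSlot.measurable_numDiscovered hs.ppp.measurable hs.measurable_Z₀ hs.measurable_Z
    hs.measurable_B hs.measurable_h hs.measurable_g, ?_⟩
  have hM' : (1 : ℝ) ≤ M := by exact_mod_cast hM
  have hp0 : 0 ≤ ρ / M := by positivity
  have hp1 : ρ / M ≤ 1 := div_le_one_of_le₀ (hρ₁.trans hM') (by linarith)
  have hratio0 (r t : ℝ) : 0 ≤ ξ * r ^ 4 / (t ^ 4 + ξ * r ^ 4) := by positivity
  have hratio1 (r t : ℝ) : ξ * r ^ 4 / (t ^ 4 + ξ * r ^ 4) ≤ 1 :=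
    div_le_one_of_le₀ (le_add_of_nonneg_left (by positivity)) (by positivity)
  have hmecke := hs.ppp.lintegral_tsum_tprod_radial hlam.le
    (f := fun r => Real.exp (-(ξ * σ ^ 2 * r ^ 4)))
    (v := fun r t => 1 - ρ / M * (ξ * r ^ 4 / (t ^ 4 + ξ * r ^ 4)))
    (D := fun y => (1 + ‖y‖) ^ (-4 : ℝ)) (by fun_prop)
    (integrable_one_add_norm (by simp; norm_num)) (fun y => by positivity)
    (fun r => (Real.exp_pos _).le) (fun r _ => by fun_prop)
    -- From `1 + u ≤ exp u` follows `exp (-u) ≤ 1 / (1 + u)`, so the previous estimate applies with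
    -- `k = ξσ²`; positive noise is what makes `k` positive.
    ⟨128 + 8 / (ξ * σ ^ 2), fun x r hr hxr _ => by
      refine le_trans ?_ (one_div_one_add_pow_four_le (by positivity) hxr)
      rw [Real.exp_neg, ← one_div]
      exact one_div_le_one_div_of_le (by positivity)
        (by linarith [Real.add_one_le_exp (ξ * σ ^ 2 * r ^ 4)])⟩
    (fun r t => sub_nonneg.2 (mul_le_one₀ hp1 (hratio0 r t) (hratio1 r t)))
    (fun r t => sub_le_self _ (mul_nonneg hp0 (hratio0 r t)))
    (fun r t hr ht => by
      refine ContinuousAt.sub continuousAt_const (continuousAt_const.mul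
        (ContinuousAt.div (by fun_prop) (by fun_prop) ?_))
      exact (add_pos (pow_pos ht 4) (mul_pos hξ (pow_pos hr 4))).ne')
    -- The ratio increases with `r`, so for `r ≤ ‖x‖` it is at most `1 / (1 + k t⁴)` with `k = 1 /
    -- (ξ‖x‖⁴)`. The case `r = 0` is separate to avoid division by zero.
    (fun x hx => ⟨128 + 8 / (1 / (ξ * ‖x‖ ^ 4)), fun y r t hr hrx _ hyt _ => by
      have hx' : 0 < ‖x‖ := norm_pos_iff.2 hx
      refine le_trans ?_ (one_div_one_add_pow_four_le (by positivity) hyt)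
      rw [sub_sub_cancel]
      refine (mul_le_of_le_one_left (hratio0 r t) hp1).trans ?_
      rcases hr.eq_or_lt with rfl | hr
      · simp
        positivity
      · rw [div_le_div_iff₀ (by positivity) (by positivity)]
        have h4 : r ^ 4 ≤ ‖x‖ ^ 4 := by gcongr
        have : ξ * r ^ 4 * (1 / (ξ * ‖x‖ ^ 4) * t ^ 4) ≤ t ^ 4 := by
          rw [← mul_assoc, mul_one_div, mul_div_mul_left _ _ hξ.ne']
          exact mul_le_of_le_one_left (by positivity) (div_le_one_of_le₀ h4 (by positivity))
        linarith⟩)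
  rw [hs.lintegral_numDiscovered_eq hlam.le hM hρ₀ hρ₁ hξ hσ, hmecke]
  simp only [sub_sub_cancel]
  rw [lintegral_plane_discovery hlam hξ hσ, ← ENNReal.ofReal_mul (mul_nonneg hρ₀ (by linarith))]
  have harg : lam * Real.pi ^ 2 * (ρ / M) / (4 * σ) = lam * Real.pi ^ 2 * ρ / (4 * M * σ) := by
    field_simp
  rw [harg]
  congr 1
  ring
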